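/- Let $D$ be a connected (finite-dimensional, real) Lie group, let $\mathfrak d=T_1D$ be its Lie algebra with the bracket defined by right-invariant vector fields, and suppose that $\dim\mathfrak d=2n$ and that $\mathfrak d$ carries an $\mathrm{Ad}$-invariant nondegenerate symmetric bilinear form $\langle\cdot,\cdot\rangle_{\mathfrak d}$ of signature $(n,n)$. Let $G\subset D$ be a connected closed subgroup whose Lie algebra $\mathfrak g\subset\mathfrak d$ is a maximal isotropic subspace. Let $S=D/G$ (the quotient by right multiplication) carry its quotient manifold structure, i.e. the one for which $p:D\to S$ is a smooth submersion, and let $D$ act on $S$ by left multiplication (the dressing action). Write $\rho_S:\mathfrak d\to\mathfrak X(S)$, $\rho_S(u)_x=\frac{d}{dt}\big|_{t=0}\exp(tu)\cdot x$, for the infinitesimal action, and $\rho=\rho_S|_{\mathfrak g}$. Let $s\in\Omega^1(S,\mathfrak d)$ be a connection splitting: $\rho_S(s(X))=X$ and $\langle s(X),s(Y)\rangle_{\mathfrak d}=0$ for all $x\in S$ and $X,Y\in T_xS$. Put $$\phi_S=\tfrac12\langle ds,s\rangle_{\mathfrak d}+\tfrac16\langle[s,s]_{\mathfrak d},s\rangle_{\mathfrak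 d}\in\Omega^3(S),\qquad \sigma(v)(X)=\langle s(X),v\rangle_{\mathfrak d}\quad(v\in\mathfrak g),$$ where the products of vector-valued forms are wedge products, normalized so that $[s,s]_{\mathfrak d}(X,Y)=2[s(X),s(Y)]_{\mathfrak d}$ and $\langle[s,s]_{\mathfrak d},s\rangle_{\mathfrak d}(X,Y,Z)=6\langle[s(X),s(Y)]_{\mathfrak d},s(Z)\rangle_{\mathfrak d}$. Suppose that $s$ is $G$-equivariant, i.e. $s(g_*X)=\mathrm{Ad}_g(s(X))$ for all $g\in G$ and $X\in TS$. Then $\sigma+\phi_S$, that is, $v\mapsto\sigma(v)+\phi_S$, is an equivariantly closed 3-form on $S$ for the dressing action of $G$: it is an element of degree $3$ of the Cartan complex $$\Omega^k_G(S)=\Big(\bigoplus_{2i+j=k}S^i(\mathfrak g^*)\otimes\Omega^j(S)\Big)^G,\qquad (d_GP)(v)=d(P(v))-i_{\rho(v)}(P(v)),$$ and $d_G(\sigma+\phi_S)=0$. (In particular $\sigma$ and $\phi_S$ are $G$-invariant, $d\phi_S=0$, $d\sigma(v)=i_{\rho(v)}\phi_S$ and $i_{\rho(v)}\sigma(v)=0$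 for all $v\in\mathfrak g$.) -/

import Mathlib

open scoped Manifold ContDiff Topology

noncomputable section

namespace GroupPair

/-! ### Differential forms on a manifold `S` modelled on `F` -/

section Forms

variable {F : Type*} [NormedAddCommGroup F] [NormedSpace ℝ F]
  {S : Type*} [TopologicalSpace S] [ChartedSpace F S]
  {V : Type*} [NormedAddCommGroup V] [NormedSpace ℝ V]
  {W : Type*} [NormedAddCommGroup W] [NormedSpace ℝ W]
  {U : Type*} [NormedAddCommGroup U] [NormedSpace ℝ U]

/-- Fields of `V`-valued alternating `k`-forms on the tangent spaces of `S` (no regularity). The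
differential forms `Ω^k(S, V)` are the fields that satisfy `IsSmoothForm`. -/
abbrev FormField (F : Type*) [NormedAddCommGroup F] [NormedSpace ℝ F]
    (S : Type*) [TopologicalSpace S] [ChartedSpace F S] (k : ℕ)
    (V : Type*) [NormedAddCommGroup V] [NormedSpace ℝ V] : Type _ :=
  ∀ x : S, TangentSpace 𝓘(ℝ, F) x [⋀^Fin k]→L[ℝ] V

/-- The expression of a form in the preferred chart at `x₀`: its pullback along the inverse of
the chart. -/
def inChart {k : ℕ} (η : FormField F S k V) (x₀ : S) (y : F) : F [⋀^Fin k]→L[ℝ] V :=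
  (η ((extChartAt 𝓘(ℝ, F) x₀).symm y)).compContinuousLinearMap
    (mfderiv 𝓘(ℝ, F) 𝓘(ℝ, F) (extChartAt 𝓘(ℝ, F) x₀).symm y)

/-- A form is smooth if its expressions in the charts are smooth. -/
def IsSmoothForm {k : ℕ} (η : FormField F S k V) : Prop :=
  ∀ x₀ : S, ContDiffOn ℝ ∞ (inChart η x₀) (extChartAt 𝓘(ℝ, F) x₀).target

/-- The exterior derivative: take the exterior derivative of the expression of the form in the
chart at `x`, and pull the result back along this chart. -/
def extD {k : ℕ} (η : FormField F S k V) : FormField F S (k + 1) V := fun x =>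
  (extDeriv (inChart η x) (extChartAt 𝓘(ℝ, F) x x)).compContinuousLinearMap
    (mfderiv 𝓘(ℝ, F) 𝓘(ℝ, F) (extChartAt 𝓘(ℝ, F) x) x)

/-- The pullback `f^* η`. -/
def pullback {k : ℕ} (f : S → S) (η : FormField F S k V) : FormField F S k V := fun x =>
  (η (f x)).compContinuousLinearMap (mfderiv 𝓘(ℝ, F) 𝓘(ℝ, F) f x)

/-- The contraction `i_X η = η(X, ·, …, ·)` with a vector field `X`. -/
def contract {k : ℕ} (X : ∀ x : S, TangentSpace 𝓘(ℝ, F) x) (η : FormField F S (k + 1) V) :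
    FormField F S k V := fun x =>
  { (η x).toAlternatingMap.curryLeft (X x) with
    cont := (η x).cont.comp (continuous_const.matrixVecCons continuous_id) }

theorem update_left_left {T : Type*} {k l : ℕ} (v : Fin (k + l) → T) (i : Fin k) (z : T) :
    (fun j => Function.update v (Fin.castAdd l i) z (Fin.castAdd l j)) =
      Function.update (fun j => v (Fin.castAdd l j)) i z := by
  funext j; by_cases hj : j = i <;> simp [hj]

theorem update_left_right {T : Type*} {k l : ℕ} (v : Fin (k + l) → T) (i : Fin k) (z : T) :
    (fun j => Function.update v (Fin.castAdd l i) z (Fin.natAdd k j)) =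
      fun j => v (Fin.natAdd k j) := by
  funext j; exact Function.update_of_ne (by simp [Fin.ext_iff]; omega) _ _

theorem update_right_left {T : Type*} {k l : ℕ} (v : Fin (k + l) → T) (i : Fin l) (z : T) :
    (fun j => Function.update v (Fin.natAdd k i) z (Fin.castAdd l j)) =
      fun j => v (Fin.castAdd l j) := by
  funext j; exact Function.update_of_ne (by simp [Fin.ext_iff]; omega) _ _

theorem update_right_right {T : Type*} {k l : ℕ} (v : Fin (k + l) → T) (i : Fin l) (z : T) :
    (fun j => Function.update v (Fin.natAdd k i) z (Fin.natAdd k j)) =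
      Function.update (fun j => v (Fin.natAdd k j)) i z := by
  funext j; by_cases hj : j = i <;> simp [hj]

/-- The product `(v₁, …, v_{k+l}) ↦ B(α(v₁, …, v_k), β(v_{k+1}, …, v_{k+l}))` of two alternating
maps along a bilinear map `B`. -/
def tensorMap {T : Type*} [AddCommGroup T] [Module ℝ T] [TopologicalSpace T]
    (B : V →L[ℝ] W →L[ℝ] U) {k l : ℕ} (α : T [⋀^Fin k]→L[ℝ] V) (β : T [⋀^Fin l]→L[ℝ] W) :
    ContinuousMultilinearMap ℝ (fun _ : Fin (k + l) => T) U where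
  toFun v := B (α fun i => v (Fin.castAdd l i)) (β fun j => v (Fin.natAdd k j))
  map_update_add' := by
    intro inst v i x y
    obtain rfl : inst = fun a b => instDecidableEqFin (k + l) a b := Subsingleton.elim _ _
    induction i using Fin.addCases with
    | left i => simp [update_left_left, update_left_right]
    | right i => simp [update_right_left, update_right_right]
  map_update_smul' := by
    intro inst v i c x
    obtain rfl : inst = fun a b => instDecidableEqFin (k + l) a b := Subsingleton.elim _ _
    induction i using Fin.addCases with
    | left i => simp [update_left_left, update_left_right]
    | right i => simp [update_right_left, update_right_right]
  cont := by
    have h1 : Continuous fun v : Fin (k + l) → T => α fun i => v (Fin.castAdd l i) :=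
      α.cont.comp (continuous_pi fun i => continuous_apply _)
    have h2 : Continuous fun v : Fin (k + l) → T => β fun j => v (Fin.natAdd k j) :=
      β.cont.comp (continuous_pi fun i => continuous_apply _)
    exact (B.continuous.comp h1).clm_apply h2

/-- The wedge product of vector-valued forms along a bilinear map `B`, normalized by
`B(α ∧ β)(v₁, …, v_{k+l}) =
  1/(k! l!) ∑_τ sign(τ) B(α(v_{τ 1}, …, v_{τ k}), β(v_{τ(k+1)}, …, v_{τ(k+l)}))`. -/
def wedge (B : V →L[ℝ] W →L[ℝ] U) {k l : ℕ} (α : FormField F S k V) (β : FormField F S l W) :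
    FormField F S (k + l) U := fun x =>
  ((k.factorial * l.factorial : ℝ)⁻¹) •
    ContinuousMultilinearMap.alternatization (tensorMap B (α x) (β x))

/-- A field of linear maps `T_x S → V`, seen as a form of degree one. -/
def oneForm (a : ∀ x : S, TangentSpace 𝓘(ℝ, F) x →L[ℝ] V) : FormField F S 1 V := fun x =>
  ContinuousAlternatingMap.ofSubsingleton ℝ (TangentSpace 𝓘(ℝ, F) x) V (0 : Fin 1) (a x)

end Forms

/-! ### The Lie algebra of `D`, with the bracket of right-invariant vector fields -/

section LieAlg

theorem mfderiv_congr_pt {E : Type*} [NormedAddCommGroup E] [NormedSpace ℝ E] {D : Type*}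
    [TopologicalSpace D] [ChartedSpace E D] (f : D → D) {a b : D} (h : a = b) (w : E) :
    (mfderiv 𝓘(ℝ, E) 𝓘(ℝ, E) f a w : E) = (mfderiv 𝓘(ℝ, E) 𝓘(ℝ, E) f b w : E) := by
  subst h; rfl

/-- The Lie algebra `𝔡 = T₁D` of `D`, as a normed space: a tangent space of `D` is a copy of the
model space `E`. -/
def LieAlg (E : Type*) [NormedAddCommGroup E] [NormedSpace ℝ E]
    (D : Type*) [TopologicalSpace D] [ChartedSpace E D] [Group D] : Type _ := E

variable {E : Type*} [NormedAddCommGroup E] [NormedSpace ℝ E]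
  {D : Type*} [TopologicalSpace D] [ChartedSpace E D] [Group D]

instance : NormedAddCommGroup (LieAlg E D) := inferInstanceAs (NormedAddCommGroup E)
instance : NormedSpace ℝ (LieAlg E D) := inferInstanceAs (NormedSpace ℝ E)
instance [FiniteDimensional ℝ E] : FiniteDimensional ℝ (LieAlg E D) :=
  inferInstanceAs (FiniteDimensional ℝ E)

/-- The tautological identification of `LieAlg E D` with the tangent space `T₁D`. -/
def toTangent : LieAlg E D ≃L[ℝ] TangentSpace 𝓘(ℝ, E) (1 : D) :=
  ContinuousLinearEquiv.refl ℝ E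

/-- The right-invariant vector field `u^r` on `D`, `u^r(a) = d(r_a)₁(u)`. -/
def rightField (u : LieAlg E D) (a : D) : TangentSpace 𝓘(ℝ, E) a :=
  (mfderiv 𝓘(ℝ, E) 𝓘(ℝ, E) (fun b : D => b * a) 1 (toTangent u) : E)

/-- The bracket `[u, v]_𝔡`: the value at `1` of the Lie bracket of the right-invariant vector
fields `u^r` and `v^r`. -/
def lieFun (u v : LieAlg E D) : LieAlg E D :=
  toTangent.symm (VectorField.mlieBracket 𝓘(ℝ, E) (rightField u) (rightField v) (1 : D))

theorem rightField_one (w : LieAlg E D) : rightField w (1 : D) = toTangent w := by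
  have h : (fun b : D => b * 1) = id := by ext; simp
  rw [rightField, h, mfderiv_id]; rfl

section
variable [LieGroup 𝓘(ℝ, E) ∞ D]

theorem mfderiv_inv_one (v : LieAlg E D) :
    (mfderiv 𝓘(ℝ, E) 𝓘(ℝ, E) (fun b : D => b⁻¹) 1 (toTangent v) : E) = -(toTangent v : E) := by
  have hinv : MDifferentiableAt 𝓘(ℝ, E) 𝓘(ℝ, E) (fun b : D => b⁻¹) 1 :=
    (contMDiff_inv 𝓘(ℝ, E) ∞).mdifferentiable (by simp) 1
  have hm : MDifferentiableAt (𝓘(ℝ, E).prod 𝓘(ℝ, E)) 𝓘(ℝ, E) (fun p : D × D => p.1 * p.2)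
      (1, 1⁻¹) := (contMDiff_mul 𝓘(ℝ, E) ∞).mdifferentiable (by simp) _
  have hid : MDifferentiableAt 𝓘(ℝ, E) 𝓘(ℝ, E) (fun b : D => b) 1 := mdifferentiableAt_id
  have h1 : mfderiv 𝓘(ℝ, E) 𝓘(ℝ, E) ((fun p : D × D => p.1 * p.2) ∘ fun b : D => (b, b⁻¹)) 1
      (toTangent v) = 0 := by
    have : ((fun p : D × D => p.1 * p.2) ∘ fun b : D => (b, b⁻¹)) = fun _ => (1 : D) := by
      ext b; simp
    rw [this, mfderiv_const]; rfl
  rw [mfderiv_comp_apply (I' := 𝓘(ℝ, E).prod 𝓘(ℝ, E)) (1 : D) hm (hid.prodMk hinv),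
    mfderiv_prod_eq_add_apply hm, mfderiv_prodMk hid hinv] at h1
  have e1 : (fun z : D => z * (1 : D)⁻¹) = id := by ext; simp
  have e2 : (fun z : D => (1 : D) * z) = id := by ext; simp
  dsimp only at h1
  rw [e1, e2, mfderiv_id, mfderiv_id] at h1
  have h3 : (mfderiv 𝓘(ℝ, E) 𝓘(ℝ, E) (fun b : D => b) 1 (toTangent v) : E) = (toTangent v : E) := by
    have := mfderiv_id (I := 𝓘(ℝ, E)) (x := (1 : D))
    exact congrArg (fun f => f (toTangent v)) this
  refine (neg_eq_of_add_eq_zero_right (Eq.trans ?_ h1)).symm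
  exact congrArg (fun w : E => w + (show E from
    mfderiv 𝓘(ℝ, E) 𝓘(ℝ, E) (fun b : D => b⁻¹) 1 (toTangent v))) h3.symm

theorem mfderiv_inv_rightField (v : LieAlg E D) (a : D) :
    mfderiv 𝓘(ℝ, E) 𝓘(ℝ, E) (fun b : D => b⁻¹) a (rightField v a) =
      mulInvariantVectorField (-toTangent v) a⁻¹ := by
  have hinv (a : D) : MDifferentiableAt 𝓘(ℝ, E) 𝓘(ℝ, E) (fun b : D => b⁻¹) a :=
    (contMDiff_inv 𝓘(ℝ, E) ∞).mdifferentiable (by simp) a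
  have hl (b : D) : MDifferentiableAt 𝓘(ℝ, E) 𝓘(ℝ, E) (fun b : D => a⁻¹ * b) b :=
    (contMDiff_mul_left (I := 𝓘(ℝ, E)) (n := ∞)).mdifferentiable (by simp) b
  have hr : MDifferentiableAt 𝓘(ℝ, E) 𝓘(ℝ, E) (fun b : D => b * a) 1 :=
    (contMDiff_mul_right (I := 𝓘(ℝ, E)) (n := ∞)).mdifferentiable (by simp) 1
  have hfun : (fun b : D => b⁻¹) ∘ (fun b : D => b * a) = (fun b => a⁻¹ * b) ∘ fun b => b⁻¹ := by
    ext b; simp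
  have h1 := mfderiv_comp_apply (1 : D) (hinv (1 * a)) hr (toTangent v)
  rw [hfun, mfderiv_comp_apply (1 : D) (hl 1⁻¹) (hinv 1)] at h1
  refine (mfderiv_congr_pt _ (one_mul a).symm _).trans (h1.symm.trans ?_)
  refine (mfderiv_congr_pt (fun b : D => a⁻¹ * b) inv_one _).trans ?_
  exact congrArg (fun w : E => (show E from
    mfderiv 𝓘(ℝ, E) 𝓘(ℝ, E) (fun b : D => a⁻¹ * b) 1 w)) (mfderiv_inv_one v)

theorem mfderiv_inv_invertible (a : D) :
    (mfderiv 𝓘(ℝ, E) 𝓘(ℝ, E) (fun b : D => b⁻¹) a).IsInvertible := by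
  let Φ : Diffeomorph 𝓘(ℝ, E) 𝓘(ℝ, E) D D ∞ :=
    ⟨Equiv.inv D, contMDiff_inv 𝓘(ℝ, E) ∞, contMDiff_inv 𝓘(ℝ, E) ∞⟩
  exact ⟨Φ.mfderivToContinuousLinearEquiv (by simp) a, Φ.mfderivToContinuousLinearEquiv_coe (by simp)⟩

theorem rightField_eq (v : LieAlg E D) :
    rightField v = VectorField.mpullback 𝓘(ℝ, E) 𝓘(ℝ, E) (fun b : D => b⁻¹)
      (mulInvariantVectorField (-toTangent v)) := by
  funext a
  rw [VectorField.mpullback_apply, ← mfderiv_inv_rightField,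
    (mfderiv_inv_invertible a).inverse_apply_self]

variable [FiniteDimensional ℝ E]

/-- The bracket of right-invariant fields is the opposite of the bracket of left-invariant
fields, which is the one that `GroupLieAlgebra` carries. -/
theorem lieFun_eq (u v : LieAlg E D) : toTangent (lieFun u v) = - ⁅toTangent u, toTangent v⁆ := by
  have h3 : minSmoothness ℝ 3 ≤ ∞ := by
    rw [minSmoothness_of_isRCLikeNormedField]; exact WithTop.coe_le_coe.2 le_top
  have h2 : minSmoothness ℝ 2 ≤ ∞ := by
    rw [minSmoothness_of_isRCLikeNormedField]; exact WithTop.coe_le_coe.2 le_top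
  have : LieGroup 𝓘(ℝ, E) (minSmoothness ℝ 3) D := LieGroup.of_le h3
  have h := VectorField.mpullback_mlieBracket (n := ∞) (I := 𝓘(ℝ, E)) (I' := 𝓘(ℝ, E))
    (f := fun b : D => b⁻¹) (x₀ := 1)
    (V := mulInvariantVectorField (-toTangent u)) (W := mulInvariantVectorField (-toTangent v))
    (mdifferentiableAt_mulInvariantVectorField _) (mdifferentiableAt_mulInvariantVectorField _)
    (contMDiff_inv 𝓘(ℝ, E) ∞ 1) h2
  rw [← rightField_eq, ← rightField_eq, ← mulInvariantVector_mlieBracket,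
    ← GroupLieAlgebra.bracket_def, neg_lie, lie_neg, neg_neg] at h
  have h' := congrFun (rightField_eq (toTangent.symm (-⁅toTangent u, toTangent v⁆))) 1
  rw [rightField_one, ContinuousLinearEquiv.apply_symm_apply, neg_neg, h] at h'
  rw [h', lieFun, ContinuousLinearEquiv.apply_symm_apply]

theorem lieFun_bilinear : IsBilinearMap ℝ (lieFun (E := E) (D := D)) := by
  have h3 : minSmoothness ℝ 3 ≤ ∞ := by
    rw [minSmoothness_of_isRCLikeNormedField]; exact WithTop.coe_le_coe.2 le_top
  have : LieGroup 𝓘(ℝ, E) (minSmoothness ℝ 3) D := LieGroup.of_le h3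
  constructor
  · intro u u' v
    exact toTangent.injective (by simp only [lieFun_eq, map_add, add_lie, neg_add])
  · intro c u v
    exact toTangent.injective (by simp only [lieFun_eq, map_smul, smul_lie, smul_neg])
  · intro u v v'
    exact toTangent.injective (by simp only [lieFun_eq, map_add, lie_add, neg_add])
  · intro c u v
    exact toTangent.injective (by simp only [lieFun_eq, map_smul, lie_smul, smul_neg])

variable (E D) in
/-- The Lie bracket `[·, ·]_𝔡` of `lieFun`, as a bilinear map. -/
def lie : LieAlg E D →L[ℝ] LieAlg E D →L[ℝ] LieAlg E D :=
  (lieFun_bilinear (E := E) (D := D)).toContinuousBilinearMap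

end

/-- The adjoint action `Ad_a` of `a ∈ D` on `𝔡`: the derivative at `1` of `b ↦ a b a⁻¹`. -/
def Ad (a : D) (u : LieAlg E D) : LieAlg E D :=
  (mfderiv 𝓘(ℝ, E) 𝓘(ℝ, E) (fun b : D => a * b * a⁻¹) 1 (toTangent u) : E)

/-- `u ∈ 𝔡` is the velocity at `1` of a smooth curve that lies in the subgroup `G`. -/
def IsVelocity (G : Subgroup D) (u : LieAlg E D) : Prop :=
  ∃ γ : ℝ → D, ContMDiff 𝓘(ℝ, ℝ) 𝓘(ℝ, E) ∞ γ ∧ γ 0 = 1 ∧ (∀ t, γ t ∈ G) ∧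
    (mfderiv 𝓘(ℝ, ℝ) 𝓘(ℝ, E) γ 0 (1 : ℝ) : E) = (toTangent u : E)

variable (E) in
/-- The Lie algebra `𝔤 = T₁G ⊆ 𝔡` of a closed subgroup `G` of `D`: the velocities at `1` of the
smooth curves in `G`. (For a closed subgroup these already form a linear subspace, and taking
the span adds nothing.) -/
def lieSub (G : Subgroup D) : Submodule ℝ (LieAlg E D) :=
  Submodule.span ℝ {u | IsVelocity G u}

theorem Ad_mem_lieSub [LieGroup 𝓘(ℝ, E) ∞ D] (G : Subgroup D) (g : G) (u : LieAlg E D)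
    (hu : u ∈ lieSub E G) : Ad (g : D) u ∈ lieSub E G := by
  have hadd (u v : LieAlg E D) : Ad (g : D) (u + v) = Ad (g : D) u + Ad (g : D) v :=
    (congrArg _ (map_add toTangent u v)).trans (map_add (mfderiv 𝓘(ℝ, E) 𝓘(ℝ, E) _ _) _ _)
  have hsmul (c : ℝ) (u : LieAlg E D) : Ad (g : D) (c • u) = c • Ad (g : D) u :=
    (congrArg _ (map_smul toTangent c u)).trans (map_smul (mfderiv 𝓘(ℝ, E) 𝓘(ℝ, E) _ _) _ _)
  induction hu using Submodule.span_induction with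
  | zero =>
    have := hsmul 0 0
    rw [zero_smul, zero_smul] at this
    rw [this]; exact zero_mem _
  | add u v _ _ hu hv => rw [hadd]; exact add_mem hu hv
  | smul c u _ hu => rw [hsmul]; exact Submodule.smul_mem _ c hu
  | mem u hu =>
    obtain ⟨γ, hγ, h0, hG, hd⟩ := hu
    have hc : ContMDiff 𝓘(ℝ, E) 𝓘(ℝ, E) ∞ (fun b : D => (g : D) * b * (g : D)⁻¹) :=
      (contMDiff_mul_right (I := 𝓘(ℝ, E)) (n := ∞)).comp contMDiff_mul_left
    refine Submodule.subset_span ⟨fun t => (g : D) * γ t * (g : D)⁻¹, hc.comp hγ, by simp [h0],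
      fun t => G.mul_mem (G.mul_mem g.2 (hG t)) (G.inv_mem g.2), ?_⟩
    have h1 := mfderiv_comp_apply (0 : ℝ) (hc.mdifferentiable (by simp) (γ 0))
      (hγ.mdifferentiable (by simp) 0) (1 : ℝ)
    refine h1.trans ((mfderiv_congr_pt _ h0 _).trans ?_)
    exact congrArg (fun w : E => (show E from
      mfderiv 𝓘(ℝ, E) 𝓘(ℝ, E) (fun b : D => (g : D) * b * (g : D)⁻¹) 1 w)) hd

/-- The adjoint action of `g ∈ G` on `𝔤`. -/
def adSub [LieGroup 𝓘(ℝ, E) ∞ D] (G : Subgroup D) (g : G) (v : lieSub E G) : lieSub E G :=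
  ⟨Ad (g : D) (v : LieAlg E D), Ad_mem_lieSub G g _ v.2⟩

end LieAlg

/-! ### Manin pairs, the dressing action, and connection splittings -/

section Manin

variable {E : Type*} [NormedAddCommGroup E] [NormedSpace ℝ E]
  {D : Type*} [TopologicalSpace D] [ChartedSpace E D] [Group D]

/-- A subspace is isotropic for the bilinear form `B`. -/
def IsIsotropic (B : LinearMap.BilinForm ℝ (LieAlg E D)) (N : Submodule ℝ (LieAlg E D)) : Prop :=
  ∀ u ∈ N, ∀ v ∈ N, B u v = 0

/-- `(𝔡, 𝔤)`, with the form `B = ⟨·, ·⟩_𝔡`, is a Manin pair with `dim 𝔡 = 2n`, integrated by the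
group pair `(D, G)`. -/
structure IsManinPair [FiniteDimensional ℝ E] [LieGroup 𝓘(ℝ, E) ∞ D] (G : Subgroup D)
    (B : LinearMap.BilinForm ℝ (LieAlg E D)) (n : ℕ) : Prop where
  finrank_eq : Module.finrank ℝ (LieAlg E D) = 2 * n
  symm : ∀ u v, B u v = B v u
  nondegenerate : B.Nondegenerate
  sigPos_eq : sigPos (LinearMap.BilinMap.toQuadraticMap B) = n
  sigNeg_eq : sigNeg (LinearMap.BilinMap.toQuadraticMap B) = n
  ad_invariant : ∀ (a : D) (u v : LieAlg E D), B (Ad a u) (Ad a v) = B u v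
  lie_mem : ∀ u ∈ lieSub E G, ∀ v ∈ lieSub E G, lie E D u v ∈ lieSub E G
  maximal_isotropic : Maximal (IsIsotropic B) (lieSub E G)

variable {F : Type*} [NormedAddCommGroup F] [NormedSpace ℝ F] {G : Subgroup D}
  [ChartedSpace F (D ⧸ G)]

variable (F) in
/-- The infinitesimal dressing action `ρ_S : 𝔡 → 𝔛(S)` on `S = D/G`: the value at `x` is the
derivative at `a = 1` of `a ↦ a • x`. -/
def rho (u : LieAlg E D) (x : D ⧸ G) : TangentSpace 𝓘(ℝ, F) x :=
  (mfderiv 𝓘(ℝ, E) 𝓘(ℝ, F) (fun a : D => a • x) 1 (toTangent u) : F)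

/-- A connection splitting, that is, an isotropic splitting `s : TS → 𝔡_S = 𝔡 × S` of
`ρ_S : 𝔡_S → TS`. It is given by a smooth 1-form `s ∈ Ω¹(S, 𝔡)` with `ρ_S ∘ s = id`. -/
structure IsConnectionSplitting (B : LinearMap.BilinForm ℝ (LieAlg E D))
    (s : ∀ x : D ⧸ G, TangentSpace 𝓘(ℝ, F) x →L[ℝ] LieAlg E D) : Prop where
  smooth : IsSmoothForm (oneForm s)
  rho_apply : ∀ (x : D ⧸ G) (X : TangentSpace 𝓘(ℝ, F) x), rho F (s x X) x = X
  isotropic : ∀ (x : D ⧸ G) (X Y : TangentSpace 𝓘(ℝ, F) x), B (s x X) (s x Y) = 0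

/-- `s` is `G`-equivariant for the dressing action on `TS` and the action
`g.(x, u) = (gx, Ad_g u)` on `𝔡_S`. -/
def IsEquivariant (s : ∀ x : D ⧸ G, TangentSpace 𝓘(ℝ, F) x →L[ℝ] LieAlg E D) : Prop :=
  ∀ (g : G) (x : D ⧸ G) (X : TangentSpace 𝓘(ℝ, F) x),
    s ((g : D) • x) (mfderiv 𝓘(ℝ, F) 𝓘(ℝ, F) (fun y : D ⧸ G => (g : D) • y) x X) =
      Ad (g : D) (s x X)

variable [FiniteDimensional ℝ E]

/-- The 3-form `φ_S = ½⟨ds, s⟩_𝔡 + ⅙⟨[s, s]_𝔡, s⟩_𝔡` on `S`. -/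
def phi [LieGroup 𝓘(ℝ, E) ∞ D] (B : LinearMap.BilinForm ℝ (LieAlg E D))
    (s : ∀ x : D ⧸ G, TangentSpace 𝓘(ℝ, F) x →L[ℝ] LieAlg E D) : FormField F (D ⧸ G) 3 ℝ :=
  (1 / 2 : ℝ) • wedge (LinearMap.toContinuousBilinearMap B) (extD (oneForm s)) (oneForm s) +
  (1 / 6 : ℝ) • wedge (LinearMap.toContinuousBilinearMap B)
    (wedge (lie E D) (oneForm s) (oneForm s)) (oneForm s)

/-- The 1-form `σ(v) = ⟨s(·), v⟩_𝔡` on `S`, for `v ∈ 𝔤`. -/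
def sigma (B : LinearMap.BilinForm ℝ (LieAlg E D))
    (s : ∀ x : D ⧸ G, TangentSpace 𝓘(ℝ, F) x →L[ℝ] LieAlg E D) (v : lieSub E G) :
    FormField F (D ⧸ G) 1 ℝ :=
  oneForm fun x => ((LinearMap.toContinuousBilinearMap B).flip (v : LieAlg E D)).comp (s x)

/-! ### The Cartan model -/

variable (E F G) in
/-- Maps `P` from `𝔤` to the (inhomogeneous) forms on `S`; `P v j` is the component of `P(v)` in
degree `j`. -/
abbrev CartanMap : Type _ := lieSub E G → ∀ j : ℕ, FormField F (D ⧸ G) j ℝ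

/-- `P` is an element of the degree `k` part
`Ω^k_G(S) = (⨁_{2i+j=k} S^i(𝔤*) ⊗ Ω^j(S))^G` of the Cartan complex for the dressing action: its
component in `Ω^j(S)` is a homogeneous polynomial in `v ∈ 𝔤` of degree `i` with `2i + j = k` (and
is zero if there is no such `i`), its values are smooth forms, and it is `G`-invariant, that is,
`g^* (P(Ad_g v)) = P(v)`. -/
structure IsCartanCochain [LieGroup 𝓘(ℝ, E) ∞ D] (k : ℕ) (P : CartanMap E F G) : Prop where
  homogeneous : ∀ i j : ℕ, 2 * i + j = k →
    ∃ m : MultilinearMap ℝ (fun _ : Fin i => lieSub E G) (FormField F (D ⧸ G) j ℝ),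
      ∀ v, P v j = m fun _ => v
  eq_zero : ∀ j : ℕ, (∀ i : ℕ, 2 * i + j ≠ k) → ∀ v, P v j = 0
  smooth : ∀ v j, IsSmoothForm (P v j)
  invariant : ∀ (g : G) (v : lieSub E G) (j : ℕ),
    pullback (fun y : D ⧸ G => (g : D) • y) (P (adSub G g v) j) = P v j

/-- The Cartan differential `(d_G P)(v) = d(P(v)) - i_{ρ(v)}(P(v))`. -/
def cartanD (P : CartanMap E F G) : CartanMap E F G := fun v j =>
  match j with
  | 0 => -contract (rho F (v : LieAlg E D)) (P v 1)
  | j + 1 => extD (P v j) - contract (rho F (v : LieAlg E D)) (P v (j + 2))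

/-- The element `σ + φ_S`, that is, `v ↦ σ(v) + φ_S`. -/
def sigmaPlusPhi [LieGroup 𝓘(ℝ, E) ∞ D] (B : LinearMap.BilinForm ℝ (LieAlg E D))
    (s : ∀ x : D ⧸ G, TangentSpace 𝓘(ℝ, F) x →L[ℝ] LieAlg E D) : CartanMap E F G := fun v j =>
  match j with
  | 1 => sigma B s v
  | 3 => phi B s
  | _ => 0

end Manin

end GroupPair

end

/-!
The curvature `ds + ½[s, s]` of the splitting takes values in `ker ρ_S`, because `ρ_S` is a
homomorphism and `ρ_S ∘ s = id`. At `aG` this kernel is `Ad_a 𝔤`, hence it is isotropic. Since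
`s` is isotropic, `φ_S` is the Chern–Simons form of `s`, so `dφ_S` is the pairing of the
curvature with itself and vanishes. For `v ∈ 𝔤` the difference `s(ρ(v)) - v` also lies in the
kernel: its square is `-2 i_{ρ(v)}σ(v)`, and its pairing with the curvature, combined with the
infinitesimal equivariance of `s`, gives `dσ(v) = i_{ρ(v)}φ_S`.
-/

namespace GroupPair

section LocalCalculus

variable {E : Type*} [NormedAddCommGroup E] [NormedSpace ℝ E]
  {F : Type*} [NormedAddCommGroup F] [NormedSpace ℝ F]
  {V : Type*} [NormedAddCommGroup V] [NormedSpace ℝ V]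

theorem fderiv_prodMk_left_apply {f : E × F → V} {a : E} {y : F}
    (hf : DifferentiableAt ℝ f (a, y)) (u : E) :
    fderiv ℝ (fun b => f (b, y)) a u = fderiv ℝ f (a, y) (u, 0) := by
  have h : HasFDerivAt (fun b => f (b, y)) _ a :=
    HasFDerivAt.comp (f := fun b => (b, y)) a hf.hasFDerivAt (hasFDerivAt_prodMk_left a y)
  simp [h.fderiv]

theorem fderiv_prodMk_right_apply {f : E × F → V} {a : E} {y : F}
    (hf : DifferentiableAt ℝ f (a, y)) (X : F) :
    fderiv ℝ (fun z => f (a, z)) y X = fderiv ℝ f (a, y) (0, X) := by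
  have h : HasFDerivAt (fun z => f (a, z)) _ y :=
    HasFDerivAt.comp (f := fun z => (a, z)) y hf.hasFDerivAt (hasFDerivAt_prodMk_right a y)
  simp [h.fderiv]

theorem eventually_differentiableAt {f : E → V} {x : E} (hf : ContDiffAt ℝ 2 f x) :
    ∀ᶠ z in 𝓝 x, DifferentiableAt ℝ f z :=
  (hf.eventually (by simp)).mono fun _ h => h.differentiableAt (by simp)

theorem eventually_differentiableAt_left {f : E × F → V} {a : E} {y : F}
    (hf : ContDiffAt ℝ 2 f (a, y)) : ∀ᶠ b in 𝓝 a, DifferentiableAt ℝ f (b, y) :=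
  ((Continuous.prodMk_left y).tendsto a).eventually (eventually_differentiableAt hf)

theorem eventually_differentiableAt_right {f : E × F → V} {a : E} {y : F}
    (hf : ContDiffAt ℝ 2 f (a, y)) : ∀ᶠ z in 𝓝 y, DifferentiableAt ℝ f (a, z) :=
  ((Continuous.prodMk_right a).tendsto y).eventually (eventually_differentiableAt hf)

theorem hasFDerivAt_fderiv {f : E → V} {x : E} (hf : ContDiffAt ℝ 2 f x) :
    HasFDerivAt (fderiv ℝ f) (fderiv ℝ (fderiv ℝ f) x) x :=
  ((hf.fderiv_right (m := 1) (by norm_num)).differentiableAt (by simp)).hasFDerivAt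

theorem hasFDerivAt_fderiv_left {f : E × F → V} {a : E} {y : F} (hf : ContDiffAt ℝ 2 f (a, y)) :
    HasFDerivAt (fun b => fderiv ℝ f (b, y))
      ((fderiv ℝ (fderiv ℝ f) (a, y)).comp (ContinuousLinearMap.inl ℝ E F)) a :=
  HasFDerivAt.comp (f := fun b => (b, y)) a (hasFDerivAt_fderiv hf) (hasFDerivAt_prodMk_left a y)

theorem hasFDerivAt_fderiv_right {f : E × F → V} {a : E} {y : F} (hf : ContDiffAt ℝ 2 f (a, y)) :
    HasFDerivAt (fun z => fderiv ℝ f (a, z))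
      ((fderiv ℝ (fderiv ℝ f) (a, y)).comp (ContinuousLinearMap.inr ℝ E F)) y :=
  HasFDerivAt.comp (f := fun z => (a, z)) y (hasFDerivAt_fderiv hf) (hasFDerivAt_prodMk_right a y)

theorem differentiableAt_fderiv_right {f : E × F → V} {a : E} {y : F}
    (hf : ContDiffAt ℝ 2 f (a, y)) (X : F) :
    DifferentiableAt ℝ (fun b => fderiv ℝ (fun z => f (b, z)) y X) a :=
  (((hasFDerivAt_fderiv_left hf).clm_apply
    (hasFDerivAt_const ((0, X) : E × F) a)).congr_of_eventuallyEq
      ((eventually_differentiableAt_left hf).mono fun _ hb =>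
        fderiv_prodMk_right_apply hb X)).differentiableAt

/-- The infinitesimal generator at `e`, in the direction `u`, of the family of maps `Φ (a, ·)`
with parameter `a`. For a local action it is the vector field of `u`; for a local multiplication
it is the right-invariant vector field of `u`. -/
noncomputable def generator (Φ : E × F → V) (e : E) (u : E) (y : F) : V :=
  fderiv ℝ (fun a => Φ (a, y)) e u

theorem eventually_generator_eq {Φ : E × F → V} {e : E} {y : F} (hΦ : ContDiffAt ℝ 2 Φ (e, y))
    (u : E) : generator Φ e u =ᶠ[𝓝 y] fun z => fderiv ℝ Φ (e, z) (u, 0) :=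
  (eventually_differentiableAt_right hΦ).mono fun _ hz => fderiv_prodMk_left_apply hz u

theorem generator_eq {Φ : E × F → V} {e : E} {y : F} (hΦ : ContDiffAt ℝ 2 Φ (e, y))
    (u : E) : generator Φ e u y = fderiv ℝ Φ (e, y) (u, 0) :=
  (eventually_generator_eq hΦ u).self_of_nhds

theorem hasFDerivAt_generator {Φ : E × F → V} {e : E} {y : F} (hΦ : ContDiffAt ℝ 2 Φ (e, y))
    (u : E) : HasFDerivAt (generator Φ e u)
      (((fderiv ℝ (fderiv ℝ Φ) (e, y)).comp (ContinuousLinearMap.inr ℝ E F)).flip (u, 0)) y := by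
  refine HasFDerivAt.congr_of_eventuallyEq ?_ (eventually_generator_eq hΦ u)
  simpa using (hasFDerivAt_fderiv_right hΦ).clm_apply (hasFDerivAt_const ((u, 0) : E × F) y)

theorem fderiv_generator_apply {Φ : E × F → V} {e : E} {y : F} (hΦ : ContDiffAt ℝ 2 Φ (e, y))
    (u : E) (X : F) :
    fderiv ℝ (generator Φ e u) y X = fderiv ℝ (fderiv ℝ Φ) (e, y) (0, X) (u, 0) := by
  simp [(hasFDerivAt_generator hΦ u).fderiv]

/-- `m` is the germ at `(e, e)` of a multiplication of class `C²` with unit `e`. Associativity is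
not part of the notion: it only enters through the local actions of `m`. -/
structure IsLocalMul (m : E × E → E) (e : E) : Prop where
  contDiffAt : ContDiffAt ℝ 2 m (e, e)
  one_mul : ∀ᶠ b in 𝓝 e, m (e, b) = b
  mul_one : ∀ᶠ b in 𝓝 e, m (b, e) = b

namespace IsLocalMul

variable {m : E × E → E} {e : E} (hm : IsLocalMul m e)
include hm

theorem generator_one (u : E) : generator m e u e = u := by
  have h : (fun a => m (a, e)) =ᶠ[𝓝 e] id := hm.mul_one
  simp [generator, h.fderiv_eq]

theorem fderiv_left (u : E) : fderiv ℝ m (e, e) (u, 0) = u := by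
  rw [← generator_eq hm.contDiffAt, hm.generator_one]

theorem fderiv_right (u : E) : fderiv ℝ m (e, e) (0, u) = u := by
  have h : (fun a => m (e, a)) =ᶠ[𝓝 e] id := hm.one_mul
  rw [← fderiv_prodMk_right_apply (hm.contDiffAt.differentiableAt (by simp)), h.fderiv_eq]
  simp

theorem eventually_generator_orbit {Φ : E × F → F} {y : F} (hΦ : ContDiffAt ℝ 2 Φ (e, y))
    (hact : ∀ᶠ b in 𝓝 e, ∀ᶠ a in 𝓝 e, Φ (m (a, b), y) = Φ (a, Φ (b, y))) (u : E) :
    (fun b => generator Φ e u (Φ (b, y))) =ᶠ[𝓝 e]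
      fun b => fderiv ℝ Φ (b, y) (generator m e u b, 0) := by
  filter_upwards [hact, hm.one_mul, eventually_differentiableAt_left hΦ,
    eventually_differentiableAt_right hm.contDiffAt] with b hb hone hΦb hmb
  have hmul : DifferentiableAt ℝ (fun a => m (a, b)) e :=
    hmb.comp e (hasFDerivAt_prodMk_left e b).differentiableAt
  have hcomp : HasFDerivAt (fun a => Φ (m (a, b), y)) _ e :=
    (hone.symm ▸ hΦb.hasFDerivAt : HasFDerivAt Φ (fderiv ℝ Φ (b, y)) (m (e, b), y)).comp e
      (hmul.hasFDerivAt.prodMk (hasFDerivAt_const y e))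
  rw [generator, generator, ← Filter.EventuallyEq.fderiv_eq hb, hcomp.fderiv]
  simp

theorem fderiv_generator_generator {Φ : E × F → F} {y : F} (hΦ : ContDiffAt ℝ 2 Φ (e, y))
    (hy : Φ (e, y) = y)
    (hact : ∀ᶠ b in 𝓝 e, ∀ᶠ a in 𝓝 e, Φ (m (a, b), y) = Φ (a, Φ (b, y))) (u v : E) :
    fderiv ℝ (generator Φ e u) y (generator Φ e v y) =
      fderiv ℝ (fderiv ℝ Φ) (e, y) (v, 0) (u, 0) +
        generator Φ e (fderiv ℝ (generator m e u) e v) y := by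
  have horbit : HasFDerivAt (fun b => Φ (b, y)) ((fderiv ℝ Φ (e, y)).comp
      (ContinuousLinearMap.inl ℝ E F)) e :=
    (hΦ.differentiableAt (by simp)).hasFDerivAt.comp e (hasFDerivAt_prodMk_left e y)
  have hfield : HasFDerivAt (generator Φ e u) (fderiv ℝ (generator Φ e u) y) (Φ (e, y)) := by
    rw [hy]; exact (hasFDerivAt_generator hΦ u).differentiableAt.hasFDerivAt
  have hleft : HasFDerivAt (fun b => generator Φ e u (Φ (b, y))) _ e :=
    HasFDerivAt.comp (f := fun b => Φ (b, y)) e hfield horbit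
  have hmul := hasFDerivAt_generator hm.contDiffAt u
  have hright := (hasFDerivAt_fderiv_left hΦ).clm_apply
    (hmul.prodMk (hasFDerivAt_const (0 : F) e))
  have h := congrArg (fun l => l v) (hleft.unique
    (hright.congr_of_eventuallyEq (hm.eventually_generator_orbit hΦ hact u)))
  rw [hmul.fderiv, generator_eq hΦ, generator_eq hΦ]
  simpa [hm.generator_one, add_comm] using h

theorem lieBracket_generator {Φ : E × F → F} {y : F} (hΦ : ContDiffAt ℝ 2 Φ (e, y))
    (hy : Φ (e, y) = y)
    (hact : ∀ᶠ b in 𝓝 e, ∀ᶠ a in 𝓝 e, Φ (m (a, b), y) = Φ (a, Φ (b, y))) (u v : E) :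
    VectorField.lieBracket ℝ (generator Φ e u) (generator Φ e v) y =
      generator Φ e (VectorField.lieBracket ℝ (generator m e u) (generator m e v) e) y := by
  rw [VectorField.lieBracket, VectorField.lieBracket, hm.fderiv_generator_generator hΦ hy hact,
    hm.fderiv_generator_generator hΦ hy hact, hm.generator_one, hm.generator_one,
    (hΦ.isSymmSndFDerivAt (by simp)).eq, add_sub_add_left_eq_sub]
  simp only [generator_eq hΦ]
  rw [← map_sub, Prod.mk_sub_mk, sub_zero]

section Conjugation

variable {c : E × E → E} (hc : ContDiffAt ℝ 2 c (e, e)) (hce : ∀ᶠ a in 𝓝 e, c (a, e) = e)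
  (hconj : ∀ᶠ a in 𝓝 e, ∀ᶠ b in 𝓝 e, m (c (a, b), a) = m (a, b))

include hc hce hconj

theorem eventually_fderiv_conj (u : E) :
    (fun a => fderiv ℝ m (e, a) (fderiv ℝ (fun b => c (a, b)) e u, 0)) =ᶠ[𝓝 e]
      fun a => fderiv ℝ m (a, e) (0, u) := by
  filter_upwards [hconj, hce, eventually_differentiableAt_left hm.contDiffAt,
    eventually_differentiableAt_right hm.contDiffAt, eventually_differentiableAt_left hc]
    with a hconj_a hce_a hm_left hm_right hc_a
  have hconj_diff : DifferentiableAt ℝ (fun b => c (a, b)) e :=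
    hc_a.comp e (hasFDerivAt_prodMk_right a e).differentiableAt
  have hcomp : HasFDerivAt (fun b => m (c (a, b), a)) _ e :=
    (hce_a.symm ▸ hm_right.hasFDerivAt :
      HasFDerivAt m (fderiv ℝ m (e, a)) (c (a, e), a)).comp e
        (hconj_diff.hasFDerivAt.prodMk (hasFDerivAt_const a e))
  rw [← fderiv_prodMk_right_apply hm_left, ← Filter.EventuallyEq.fderiv_eq hconj_a, hcomp.fderiv]
  simp

/-- The derivative of the adjoint action of a local group is the bracket of right-invariant
vector fields: differentiate `(a b a⁻¹) a = a b` in `b` and then in `a`. -/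
theorem fderiv_fderiv_conj (u v : E) :
    fderiv ℝ (fun a => fderiv ℝ (fun b => c (a, b)) e u) e v =
      VectorField.lieBracket ℝ (generator m e u) (generator m e v) e := by
  have hAd := (differentiableAt_fderiv_right hc u).hasFDerivAt
  have hev := hm.eventually_fderiv_conj hc hce hconj u
  have hAd_one : fderiv ℝ (fun b => c (e, b)) e u = u := by
    simpa only [hm.fderiv_left, hm.fderiv_right] using hev.self_of_nhds
  have hleft := (hasFDerivAt_fderiv_right hm.contDiffAt).clm_apply
    (hAd.prodMk (hasFDerivAt_const (0 : E) e))
  have hright := (hasFDerivAt_fderiv_left hm.contDiffAt).clm_apply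
    (hasFDerivAt_const ((0, u) : E × E) e)
  have h := congrArg (fun l => l v) ((hleft.congr_of_eventuallyEq hev.symm).unique hright)
  have hsnd : fderiv ℝ (fun a => fderiv ℝ (fun b => c (a, b)) e u) e v +
      fderiv ℝ (fderiv ℝ m) (e, e) (0, v) (u, 0) =
        fderiv ℝ (fderiv ℝ m) (e, e) (v, 0) (0, u) := by
    simpa [hAd_one, hm.fderiv_left] using h
  rw [VectorField.lieBracket, hm.generator_one, hm.generator_one,
    fderiv_generator_apply hm.contDiffAt, fderiv_generator_apply hm.contDiffAt,
    (hm.contDiffAt.isSymmSndFDerivAt (by simp)).eq (0, u), ← hsnd, add_sub_cancel_right]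

end Conjugation

end IsLocalMul

theorem hasDerivAt_fderiv_right_along {Φ : E × F → V} {y : F} {γ : ℝ → E} {v : E}
    (hγ : HasDerivAt γ v 0) (hΦ : ContDiffAt ℝ 2 Φ (γ 0, y)) (X : F) :
    HasDerivAt (fun t => fderiv ℝ (fun z => Φ (γ t, z)) y X)
      (fderiv ℝ (generator Φ (γ 0) v) y X) 0 := by
  have hcurve : HasDerivAt (fun t => (γ t, y)) (v, (0 : F)) 0 := hγ.prodMk (hasDerivAt_const 0 y)
  have hderiv : HasDerivAt (fun t => fderiv ℝ Φ (γ t, y))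
      (fderiv ℝ (fderiv ℝ Φ) (γ 0, y) (v, 0)) 0 :=
    (hasFDerivAt_fderiv hΦ).comp_hasDerivAt (0 : ℝ) hcurve
  have h := hderiv.clm_apply (hasDerivAt_const (0 : ℝ) ((0, X) : E × F))
  rw [map_zero, add_zero, (hΦ.isSymmSndFDerivAt (by simp)).eq, ← fderiv_generator_apply hΦ] at h
  exact h.congr_of_eventuallyEq
    ((hcurve.continuousAt.eventually (eventually_differentiableAt hΦ)).mono
      fun t ht => fderiv_prodMk_right_apply ht X)

theorem infinitesimal_equivariance {Φ : E × F → F} {y : F} {s : F → F →L[ℝ] V}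
    (hs : DifferentiableAt ℝ s y) {γ : ℝ → E} {v : E} (hγ : HasDerivAt γ v 0)
    (hΦ : ContDiffAt ℝ 2 Φ (γ 0, y)) (hone : ∀ᶠ z in 𝓝 y, Φ (γ 0, z) = z)
    {α : ℝ → V} {α' : V} (hα : HasDerivAt α α' 0) (X : F)
    (heq : ∀ᶠ t in 𝓝 (0 : ℝ), s (Φ (γ t, y)) (fderiv ℝ (fun z => Φ (γ t, z)) y X) = α t) :
    fderiv ℝ s y (generator Φ (γ 0) v y) X + s y (fderiv ℝ (generator Φ (γ 0) v) y X) = α' := by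
  have hy : Φ (γ 0, y) = y := hone.self_of_nhds
  have hX : fderiv ℝ (fun z => Φ (γ 0, z)) y X = X := by
    have h : (fun z => Φ (γ 0, z)) =ᶠ[𝓝 y] id := hone
    simp [h.fderiv_eq]
  have horbit : HasDerivAt (fun t => Φ (γ t, y)) (generator Φ (γ 0) v y) 0 := by
    rw [generator_eq hΦ]
    exact (hΦ.differentiableAt (by simp)).hasFDerivAt.comp_hasDerivAt (0 : ℝ)
      (hγ.prodMk (hasDerivAt_const 0 y))
  have hs_orbit : HasDerivAt (fun t => s (Φ (γ t, y)))
      (fderiv ℝ s y (generator Φ (γ 0) v y)) 0 :=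
    (hy.symm ▸ hs.hasFDerivAt : HasFDerivAt s (fderiv ℝ s y) (Φ (γ 0, y))).comp_hasDerivAt
      (0 : ℝ) horbit
  have h := hs_orbit.clm_apply (hasDerivAt_fderiv_right_along hγ hΦ X)
  rw [hX, hy] at h
  exact ((hα.congr_of_eventuallyEq heq).unique h).symm

end LocalCalculus

section Charts

variable {E : Type*} [NormedAddCommGroup E] [NormedSpace ℝ E]
  {M : Type*} [TopologicalSpace M] [ChartedSpace E M]
  {E' : Type*} [NormedAddCommGroup E'] [NormedSpace ℝ E']
  {N : Type*} [TopologicalSpace N] [ChartedSpace E' N]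
  {E₂ : Type*} [NormedAddCommGroup E₂] [NormedSpace ℝ E₂]
  {P : Type*} [TopologicalSpace P] [ChartedSpace E₂ P]

/-- The tangent map of `f` at `x`, as a map between the model spaces, of which the tangent spaces
are copies: tangent vectors at equal but not syntactically equal points can then be compared. -/
noncomputable def tmap (E E' : Type*) [NormedAddCommGroup E] [NormedSpace ℝ E]
    [NormedAddCommGroup E'] [NormedSpace ℝ E'] {M : Type*} [TopologicalSpace M] [ChartedSpace E M]
    {N : Type*} [TopologicalSpace N] [ChartedSpace E' N] (f : M → N) (x : M) : E →L[ℝ] E' :=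
  mfderiv 𝓘(ℝ, E) 𝓘(ℝ, E') f x

theorem tmap_comp {g : N → P} {f : M → N} (x : M)
    (hg : MDifferentiableAt 𝓘(ℝ, E') 𝓘(ℝ, E₂) g (f x))
    (hf : MDifferentiableAt 𝓘(ℝ, E) 𝓘(ℝ, E') f x) :
    tmap E E₂ (fun z => g (f z)) x = (tmap E' E₂ g (f x)).comp (tmap E E' f x) :=
  mfderiv_comp x hg hf

theorem tmap_id (x : M) : tmap E E (fun z : M => z) x = ContinuousLinearMap.id ℝ E :=
  mfderiv_id

theorem tmap_congr {f g : M → N} {x : M} (h : f =ᶠ[𝓝 x] g) : tmap E E' f x = tmap E E' g x :=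
  h.mfderiv_eq

theorem tmap_eq_fderiv (f : E → E') (x : E) : tmap E E' f x = fderiv ℝ f x :=
  mfderiv_eq_fderiv

theorem tmap_comp_eq_id {g : N → M} {f : M → N} {x : M} (h : ∀ᶠ z in 𝓝 x, g (f z) = z)
    (hg : MDifferentiableAt 𝓘(ℝ, E') 𝓘(ℝ, E) g (f x))
    (hf : MDifferentiableAt 𝓘(ℝ, E) 𝓘(ℝ, E') f x) :
    (tmap E' E g (f x)).comp (tmap E E' f x) = ContinuousLinearMap.id ℝ E := by
  rw [← tmap_comp x hg hf, tmap_congr h, tmap_id]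

/-- The expression of `f` in the preferred charts at `x` and `y`, where `y` need not be `f x`. -/
noncomputable def inCharts (E E' : Type*) [NormedAddCommGroup E] [NormedSpace ℝ E]
    [NormedAddCommGroup E'] [NormedSpace ℝ E'] {M : Type*} [TopologicalSpace M] [ChartedSpace E M]
    {N : Type*} [TopologicalSpace N] [ChartedSpace E' N] (f : M → N) (x : M) (y : N) : E → E' :=
  fun z => extChartAt 𝓘(ℝ, E') y (f ((extChartAt 𝓘(ℝ, E) x).symm z))

variable [IsManifold 𝓘(ℝ, E) ∞ M] [IsManifold 𝓘(ℝ, E') ∞ N]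

theorem contMDiffAt_chart {x p : M} (hp : p ∈ (extChartAt 𝓘(ℝ, E) x).source) :
    ContMDiffAt 𝓘(ℝ, E) 𝓘(ℝ, E) ∞ (extChartAt 𝓘(ℝ, E) x) p :=
  contMDiffAt_extChartAt' (by rwa [extChartAt_source] at hp)

theorem contMDiffAt_chart_symm {x : M} {z : E} (hz : z ∈ (extChartAt 𝓘(ℝ, E) x).target) :
    ContMDiffAt 𝓘(ℝ, E) 𝓘(ℝ, E) ∞ (extChartAt 𝓘(ℝ, E) x).symm z :=
  (contMDiffOn_extChartAt_symm x).contMDiffAt (extChartAt_target_mem_nhds' hz)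

theorem mdifferentiableAt_chart {x p : M} (hp : p ∈ (extChartAt 𝓘(ℝ, E) x).source) :
    MDifferentiableAt 𝓘(ℝ, E) 𝓘(ℝ, E) (extChartAt 𝓘(ℝ, E) x) p :=
  (contMDiffAt_chart hp).mdifferentiableAt (by simp)

theorem mdifferentiableAt_chart_symm {x : M} {z : E}
    (hz : z ∈ (extChartAt 𝓘(ℝ, E) x).target) :
    MDifferentiableAt 𝓘(ℝ, E) 𝓘(ℝ, E) (extChartAt 𝓘(ℝ, E) x).symm z :=
  (contMDiffAt_chart_symm hz).mdifferentiableAt (by simp)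

theorem tmap_chart_self (x : M) :
    tmap E E (extChartAt 𝓘(ℝ, E) x) x = ContinuousLinearMap.id ℝ E := by
  have : IsManifold 𝓘(ℝ, E) 1 M := IsManifold.of_le (n := ∞) (by simp)
  exact mfderiv_extChartAt_self

theorem tmap_chart_comp_symm {x : M} {z : E} (hz : z ∈ (extChartAt 𝓘(ℝ, E) x).target) :
    (tmap E E (extChartAt 𝓘(ℝ, E) x) ((extChartAt 𝓘(ℝ, E) x).symm z)).comp
      (tmap E E (extChartAt 𝓘(ℝ, E) x).symm z) = ContinuousLinearMap.id ℝ E := by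
  refine tmap_comp_eq_id ?_ (mdifferentiableAt_chart ((extChartAt 𝓘(ℝ, E) x).map_target hz))
    (mdifferentiableAt_chart_symm hz)
  filter_upwards [extChartAt_target_mem_nhds' hz] with w hw
  exact (extChartAt 𝓘(ℝ, E) x).right_inv hw

theorem tmap_symm_comp_chart {x p : M} (hp : p ∈ (extChartAt 𝓘(ℝ, E) x).source) :
    (tmap E E (extChartAt 𝓘(ℝ, E) x).symm (extChartAt 𝓘(ℝ, E) x p)).comp
      (tmap E E (extChartAt 𝓘(ℝ, E) x) p) = ContinuousLinearMap.id ℝ E := by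
  refine tmap_comp_eq_id ?_ (mdifferentiableAt_chart_symm
    ((extChartAt 𝓘(ℝ, E) x).map_source hp)) (mdifferentiableAt_chart hp)
  filter_upwards [extChartAt_source_mem_nhds' hp] with w hw
  exact (extChartAt 𝓘(ℝ, E) x).left_inv hw

theorem tmap_symm_self (x : M) :
    tmap E E (extChartAt 𝓘(ℝ, E) x).symm (extChartAt 𝓘(ℝ, E) x x) =
      ContinuousLinearMap.id ℝ E := by
  have h := tmap_symm_comp_chart (mem_extChartAt_source (I := 𝓘(ℝ, E)) x)
  rwa [tmap_chart_self, ContinuousLinearMap.comp_id] at h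

theorem fderiv_inCharts {f : M → N} {x : M} {y : N} {z : E}
    (hz : z ∈ (extChartAt 𝓘(ℝ, E) x).target)
    (hf : MDifferentiableAt 𝓘(ℝ, E) 𝓘(ℝ, E') f ((extChartAt 𝓘(ℝ, E) x).symm z))
    (hy : f ((extChartAt 𝓘(ℝ, E) x).symm z) ∈ (extChartAt 𝓘(ℝ, E') y).source) :
    fderiv ℝ (inCharts E E' f x y) z =
      (tmap E' E' (extChartAt 𝓘(ℝ, E') y) (f ((extChartAt 𝓘(ℝ, E) x).symm z))).comp
        ((tmap E E' f ((extChartAt 𝓘(ℝ, E) x).symm z)).comp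
          (tmap E E (extChartAt 𝓘(ℝ, E) x).symm z)) := by
  rw [← tmap_eq_fderiv, ← tmap_comp z hf (mdifferentiableAt_chart_symm hz)]
  exact tmap_comp z (mdifferentiableAt_chart hy) (hf.comp z (mdifferentiableAt_chart_symm hz))

theorem fderiv_inCharts_self {f : M → N} {x : M} {y : N}
    (hf : MDifferentiableAt 𝓘(ℝ, E) 𝓘(ℝ, E') f x)
    (hy : f x ∈ (extChartAt 𝓘(ℝ, E') y).source) :
    fderiv ℝ (inCharts E E' f x y) (extChartAt 𝓘(ℝ, E) x x) =
      (tmap E' E' (extChartAt 𝓘(ℝ, E') y) (f x)).comp (tmap E E' f x) := by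
  have hx := extChartAt_to_inv (I := 𝓘(ℝ, E)) x
  rw [fderiv_inCharts (mem_extChartAt_target x) (by rwa [hx]) (by rwa [hx]), tmap_symm_self,
    ContinuousLinearMap.comp_id, hx]

theorem contDiffAt_inCharts {f : M → N} {x : M} {y : N} (hf : ContMDiffAt 𝓘(ℝ, E) 𝓘(ℝ, E') ∞ f x)
    (hy : f x ∈ (extChartAt 𝓘(ℝ, E') y).source) :
    ContDiffAt ℝ ∞ (inCharts E E' f x y) (extChartAt 𝓘(ℝ, E) x x) := by
  have hx := extChartAt_to_inv (I := 𝓘(ℝ, E)) x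
  exact contMDiffAt_iff_contDiffAt.1 <|
    (contMDiffAt_chart (by rwa [hx])).comp _
      (ContMDiffAt.comp _ (by rwa [hx]) (contMDiffAt_chart_symm (mem_extChartAt_target x)))

end Charts

section Naturality

variable {F : Type*} [NormedAddCommGroup F] [NormedSpace ℝ F]
  {S : Type*} [TopologicalSpace S] [ChartedSpace F S]
  {V : Type*} [NormedAddCommGroup V] [NormedSpace ℝ V]

/-- The form `η` with the tangent spaces replaced by the model space of which they are copies. -/
def FormField.toModel {k : ℕ} (η : FormField F S k V) : S → F [⋀^Fin k]→L[ℝ] V := η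

theorem inChart_apply {k : ℕ} (η : FormField F S k V) (x : S) (y : F) (v : Fin k → F) :
    inChart η x y v = η.toModel ((extChartAt 𝓘(ℝ, F) x).symm y)
      (fun i => tmap F F (extChartAt 𝓘(ℝ, F) x).symm y (v i)) := rfl

theorem pullback_toModel_apply {k : ℕ} (f : S → S) (η : FormField F S k V) (x : S)
    (v : Fin k → F) :
    (pullback f η).toModel x v = η.toModel (f x) (fun i => tmap F F f x (v i)) := rfl

theorem pullback_id {k : ℕ} (η : FormField F S k V) : pullback (fun x => x) η = η := by
  funext x
  refine ContinuousAlternatingMap.ext fun (v : Fin k → F) => ?_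
  change (pullback (fun x => x) η).toModel x v = η.toModel x v
  simp only [pullback_toModel_apply, tmap_id, ContinuousLinearMap.id_apply]

theorem IsSmoothForm.differentiableAt {k : ℕ} {η : FormField F S k V} (hη : IsSmoothForm η)
    {x : S} {y : F} (hy : y ∈ (extChartAt 𝓘(ℝ, F) x).target) :
    DifferentiableAt ℝ (inChart η x) y :=
  ((hη x).contDiffAt (extChartAt_target_mem_nhds' hy)).differentiableAt (by simp)

variable [IsManifold 𝓘(ℝ, F) ∞ S]

theorem extD_toModel_apply {k : ℕ} (η : FormField F S k V) (x : S) (v : Fin (k + 1) → F) :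
    (extD η).toModel x v = extDeriv (inChart η x) (extChartAt 𝓘(ℝ, F) x x) v := by
  change extDeriv (inChart η x) (extChartAt 𝓘(ℝ, F) x x)
    (fun i => tmap F F (extChartAt 𝓘(ℝ, F) x) x (v i)) = _
  simp only [tmap_chart_self, ContinuousLinearMap.id_apply]

theorem inChart_pullback_eventuallyEq {k : ℕ} (η : FormField F S k V) {f : S → S}
    (hf : ContMDiff 𝓘(ℝ, F) 𝓘(ℝ, F) ∞ f) {x y : S} (hx : f x ∈ (extChartAt 𝓘(ℝ, F) y).source) :
    inChart (pullback f η) x =ᶠ[𝓝 (extChartAt 𝓘(ℝ, F) x x)] fun z =>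
      (inChart η y (inCharts F F f x y z)).compContinuousLinearMap
        (fderiv ℝ (inCharts F F f x y) z) := by
  set ψ := extChartAt 𝓘(ℝ, F) x
  set χ := extChartAt 𝓘(ℝ, F) y with hχ
  have hcont : ContinuousAt (fun z => f (ψ.symm z)) (ψ x) :=
    hf.continuous.continuousAt.comp (continuousAt_extChartAt_symm x)
  have hsource : ∀ᶠ z in 𝓝 (ψ x), f (ψ.symm z) ∈ χ.source :=
    hcont.eventually ((isOpen_extChartAt_source y).mem_nhds
      (by simpa only [ψ, extChartAt_to_inv] using hx))
  filter_upwards [hsource, extChartAt_target_mem_nhds (I := 𝓘(ℝ, F)) x] with z hz hz'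
  ext w
  have hsymm : χ.symm (inCharts F F f x y z) = f (ψ.symm z) := χ.left_inv hz
  have hcancel (X : F) : tmap F F χ.symm (inCharts F F f x y z)
      (tmap F F χ (f (ψ.symm z)) X) = X :=
    congrArg (fun l => l X) (tmap_symm_comp_chart hz)
  rw [ContinuousAlternatingMap.compContinuousLinearMap_apply, inChart_apply, inChart_apply,
    hsymm, pullback_toModel_apply, fderiv_inCharts hz' (hf.mdifferentiable (by simp) _) hz]
  simp only [Function.comp_apply, ContinuousLinearMap.comp_apply, ← hχ, hcancel, ψ]

theorem extD_pullback_in_chart {k : ℕ} {η : FormField F S k V} (hη : IsSmoothForm η) {f : S → S}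
    (hf : ContMDiff 𝓘(ℝ, F) 𝓘(ℝ, F) ∞ f) {x y : S} (hx : f x ∈ (extChartAt 𝓘(ℝ, F) y).source)
    (v : Fin (k + 1) → F) :
    (extD (pullback f η)).toModel x v =
      extDeriv (inChart η y) (extChartAt 𝓘(ℝ, F) y (f x))
        (fun i => tmap F F (extChartAt 𝓘(ℝ, F) y) (f x) (tmap F F f x (v i))) := by
  have hval : inCharts F F f x y (extChartAt 𝓘(ℝ, F) x x) = extChartAt 𝓘(ℝ, F) y (f x) := by
    simp only [inCharts, extChartAt_to_inv]
  have hη' := hη.differentiableAt ((extChartAt 𝓘(ℝ, F) y).map_source hx)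
  rw [extD_toModel_apply, (inChart_pullback_eventuallyEq η hf hx).extDeriv_eq,
    extDeriv_pullback (r := ∞) (by rwa [hval]) (contDiffAt_inCharts hf.contMDiffAt hx) (by
      rw [minSmoothness_of_isRCLikeNormedField]; exact WithTop.coe_le_coe.2 le_top),
    fderiv_inCharts_self (hf.mdifferentiable (by simp) _) hx, hval]
  rfl

theorem inChart_extD {k : ℕ} {η : FormField F S k V} (hη : IsSmoothForm η) {x : S} {y : F}
    (hy : y ∈ (extChartAt 𝓘(ℝ, F) x).target) :
    inChart (extD η) x y = extDeriv (inChart η x) y := by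
  ext v
  have h := extD_pullback_in_chart hη (f := fun x => x) contMDiff_id
    ((extChartAt 𝓘(ℝ, F) x).map_target hy)
    (fun i => tmap F F (extChartAt 𝓘(ℝ, F) x).symm y (v i))
  rw [pullback_id, (extChartAt 𝓘(ℝ, F) x).right_inv hy, tmap_id] at h
  rw [inChart_apply, h]
  congr 1
  funext i
  exact congrArg (fun l => l (v i)) (tmap_chart_comp_symm hy)

theorem extD_pullback {k : ℕ} {η : FormField F S k V} (hη : IsSmoothForm η) {f : S → S}
    (hf : ContMDiff 𝓘(ℝ, F) 𝓘(ℝ, F) ∞ f) : extD (pullback f η) = pullback f (extD η) := by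
  funext x
  ext v
  exact extD_pullback_in_chart hη hf (mem_extChartAt_source (f x)) v

theorem contDiffOn_alternating [FiniteDimensional ℝ F] [FiniteDimensional ℝ V] {k : ℕ}
    {β : F → F [⋀^Fin k]→L[ℝ] V} {T : Set F}
    (h : ∀ v : Fin k → F, ContDiffOn ℝ ∞ (fun y => β y v) T) : ContDiffOn ℝ ∞ β T := by
  let b := Module.finBasis ℝ F
  let evalBasis : (F [⋀^Fin k]→L[ℝ] V) →ₗ[ℝ] ((Fin k → Fin (Module.finrank ℝ F)) → V) :=
    { toFun := fun α i => α fun j => b (i j)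
      map_add' := fun _ _ => rfl
      map_smul' := fun _ _ => rfl }
  have hker : LinearMap.ker evalBasis = ⊥ := by
    refine LinearMap.ker_eq_bot.2 fun α α' hαα' => ?_
    have hmul : α.toMultilinearMap = α'.toMultilinearMap :=
      Module.Basis.ext_multilinear (fun _ => b) fun i => congrFun hαα' i
    ext v
    exact congrArg (fun m => m v) hmul
  obtain ⟨l, hl⟩ := evalBasis.exists_leftInverse_of_injective hker
  have hβ : β = fun y => LinearMap.toContinuousLinearMap l (fun i => β y fun j => b (i j)) :=
    funext fun y => (congrArg (fun f => f (β y)) hl).symm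
  rw [hβ]
  exact (ContinuousLinearMap.contDiff _).comp_contDiffOn (contDiffOn_pi.2 fun i => h _)

end Naturality

section Submersion

variable {E : Type*} [NormedAddCommGroup E] [NormedSpace ℝ E]
  {F : Type*} [NormedAddCommGroup F] [NormedSpace ℝ F]
  {M : Type*} [TopologicalSpace M] [ChartedSpace E M]
  {N : Type*} [TopologicalSpace N] [ChartedSpace F N]

theorem submersion_in_charts {p : M → N} {a : M}
    (h : Manifold.IsSubmersionAt 𝓘(ℝ, E) 𝓘(ℝ, F) ∞ p a) {w : E} (hw : w ∈ h.domChart.target) :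
    h.codChart (p (h.domChart.symm w)) = (h.equiv w).1 := by
  simpa using h.writtenInCharts
    (show w ∈ (h.domChart.extend 𝓘(ℝ, E)).target by simpa using hw)

theorem submersion_eq_of_fst_eq {p : M → N} {a : M}
    (h : Manifold.IsSubmersionAt 𝓘(ℝ, E) 𝓘(ℝ, F) ∞ p a) {w : E} (hw : w ∈ h.domChart.target)
    {q : N} (hq : q ∈ h.codChart.source) (heq : (h.equiv w).1 = h.codChart q) :
    p (h.domChart.symm w) = q :=
  h.codChart.injOn (h.source_subset_preimage_source (h.domChart.map_target hw)) hq
    ((submersion_in_charts h hw).trans heq)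

theorem contMDiffAt_domChart {p : M → N} {a : M}
    (h : Manifold.IsSubmersionAt 𝓘(ℝ, E) 𝓘(ℝ, F) ∞ p a) :
    ContMDiffAt 𝓘(ℝ, E) 𝓘(ℝ, E) ∞ h.domChart a :=
  (contMDiffOn_of_mem_maximalAtlas h.domChart_mem_maximalAtlas).contMDiffAt
    (h.domChart.open_source.mem_nhds h.mem_domChart_source)

theorem contMDiffAt_codChart {p : M → N} {a : M}
    (h : Manifold.IsSubmersionAt 𝓘(ℝ, E) 𝓘(ℝ, F) ∞ p a) :
    ContMDiffAt 𝓘(ℝ, F) 𝓘(ℝ, F) ∞ h.codChart (p a) :=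
  (contMDiffOn_of_mem_maximalAtlas h.codChart_mem_maximalAtlas).contMDiffAt
    (h.codChart.open_source.mem_nhds h.mem_codChart_source)

theorem contMDiffAt_domChart_symm {p : M → N} {a : M}
    (h : Manifold.IsSubmersionAt 𝓘(ℝ, E) 𝓘(ℝ, F) ∞ p a) {w : E} (hw : w ∈ h.domChart.target) :
    ContMDiffAt 𝓘(ℝ, E) 𝓘(ℝ, E) ∞ h.domChart.symm w :=
  (contMDiffOn_symm_of_mem_maximalAtlas h.domChart_mem_maximalAtlas).contMDiffAt
    (h.domChart.open_target.mem_nhds hw)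

theorem codChart_submersion {p : M → N} {a : M}
    (h : Manifold.IsSubmersionAt 𝓘(ℝ, E) 𝓘(ℝ, F) ∞ p a) {b : M} (hb : b ∈ h.domChart.source) :
    h.codChart (p b) = (h.equiv (h.domChart b)).1 := by
  simpa only [h.domChart.left_inv hb] using submersion_in_charts h (h.domChart.map_source hb)

theorem exists_local_section {p : M → N} {a : M}
    (h : Manifold.IsSubmersionAt 𝓘(ℝ, E) 𝓘(ℝ, F) ∞ p a) :
    ∃ σ : N → M, ContMDiffAt 𝓘(ℝ, F) 𝓘(ℝ, E) ∞ σ (p a) ∧ ∀ᶠ q in 𝓝 (p a), p (σ q) = q := by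
  set c := (h.equiv (h.domChart a)).2 with hc
  let τ : N → E := fun q => h.equiv.symm (h.codChart q, c)
  have ha_target := h.domChart.map_source h.mem_domChart_source
  have hτa : τ (p a) = h.domChart a := by
    simp only [τ, codChart_submersion h h.mem_domChart_source, hc]
    exact h.equiv.symm_apply_apply _
  have hτ : ContMDiffAt 𝓘(ℝ, F) 𝓘(ℝ, E) ∞ τ (p a) := by
    have hlin : ContDiff ℝ ∞ fun z : F => h.equiv.symm (z, c) :=
      h.equiv.symm.contDiff.comp (contDiff_id.prodMk contDiff_const)
    exact hlin.contMDiff.contMDiffAt.comp (p a) (contMDiffAt_codChart h)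
  have hτ_target : ∀ᶠ q in 𝓝 (p a), τ q ∈ h.domChart.target :=
    hτ.continuousAt.eventually (h.domChart.open_target.mem_nhds (by rwa [hτa]))
  refine ⟨fun q => h.domChart.symm (τ q),
    ContMDiffAt.comp (p a) (contMDiffAt_domChart_symm h (by rwa [hτa])) hτ, ?_⟩
  filter_upwards [hτ_target, h.codChart.open_source.mem_nhds h.mem_codChart_source] with q hq hq'
  exact submersion_eq_of_fst_eq h hq hq' (by simp [τ])

theorem fst_equiv_tmap_domChart {p : M → N} {a : M}
    (h : Manifold.IsSubmersionAt 𝓘(ℝ, E) 𝓘(ℝ, F) ∞ p a) (u : E) :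
    (h.equiv (tmap E E h.domChart a u)).1 = tmap F F h.codChart (p a) (tmap E F p a u) := by
  let fstEquiv : E →L[ℝ] F :=
    (ContinuousLinearMap.fst ℝ F _).comp (h.equiv : E →L[ℝ] F × h.complement)
  have hchart : (fun b => h.codChart (p b)) =ᶠ[𝓝 a] fun b => fstEquiv (h.domChart b) := by
    filter_upwards [h.domChart.open_source.mem_nhds h.mem_domChart_source] with b hb
    exact codChart_submersion h hb
  have htmap := tmap_congr (E := E) (E' := F) hchart
  rw [tmap_comp a ((contMDiffAt_codChart h).mdifferentiableAt (by simp))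
      (h.contMDiffAt.mdifferentiableAt (by simp)),
    tmap_comp (g := fstEquiv) a fstEquiv.mdifferentiableAt
      ((contMDiffAt_domChart h).mdifferentiableAt (by simp)),
    tmap_eq_fderiv, fstEquiv.fderiv] at htmap
  exact (congrArg (fun l => l u) htmap).symm

theorem exists_bounded_reparametrization {T : Set E} (hT : IsOpen T) {x : E} (hx : x ∈ T) (w : E) :
    ∃ r : ℝ → ℝ, ContDiff ℝ ∞ r ∧ r 0 = 0 ∧ HasDerivAt r 1 0 ∧ ∀ t, x + r t • w ∈ T := by
  obtain ⟨ε, hε, hball⟩ := Metric.isOpen_iff.1 hT x hx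
  set δ := ε / (‖w‖ + 1) with hδ
  have hδ_pos : 0 < δ := by positivity
  refine ⟨fun t => δ * Real.sin (t / δ),
    contDiff_const.mul (Real.contDiff_sin.comp (contDiff_id.div_const δ)), by simp, ?_,
    fun t => hball ?_⟩
  · simpa [hδ_pos.ne'] using (((hasDerivAt_id (0 : ℝ)).div_const δ).sin).const_mul δ
  · rw [Metric.mem_ball, dist_eq_norm, add_sub_cancel_left, norm_smul, norm_mul, Real.norm_eq_abs,
      Real.norm_eq_abs, abs_of_pos hδ_pos]
    calc δ * |Real.sin (t / δ)| * ‖w‖ ≤ δ * 1 * ‖w‖ := by gcongr; exact Real.abs_sin_le_one _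
      _ < δ * (‖w‖ + 1) := by nlinarith
      _ = ε := by rw [hδ]; field_simp

theorem exists_curve_in_fibre {p : M → N} {a : M}
    (h : Manifold.IsSubmersionAt 𝓘(ℝ, E) 𝓘(ℝ, F) ∞ p a) {u : E} (hu : tmap E F p a u = 0) :
    ∃ γ : ℝ → M, ContMDiff 𝓘(ℝ, ℝ) 𝓘(ℝ, E) ∞ γ ∧ γ 0 = a ∧ (∀ t, p (γ t) = p a) ∧
      tmap ℝ E γ 0 1 = u := by
  have ha := h.mem_domChart_source
  have ha_target := h.domChart.map_source ha
  set w := tmap E E h.domChart a u with hw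
  have hw_fst : (h.equiv w).1 = 0 := by rw [hw, fst_equiv_tmap_domChart, hu, map_zero]
  obtain ⟨r, hr, hr_zero, hr_deriv, hr_target⟩ :=
    exists_bounded_reparametrization h.domChart.open_target ha_target w
  have hline : HasDerivAt (fun t => h.domChart a + r t • w) w 0 := by
    simpa only [one_smul] using (hr_deriv.smul_const w).const_add (h.domChart a)
  have hline_smooth : ContDiff ℝ ∞ fun t => h.domChart a + r t • w :=
    contDiff_const.add (hr.smul contDiff_const)
  have hline_zero : h.domChart a + r 0 • w = h.domChart a := by rw [hr_zero, zero_smul, add_zero]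
  refine ⟨fun t => h.domChart.symm (h.domChart a + r t • w), fun t =>
    (contMDiffAt_domChart_symm h (hr_target t)).comp t hline_smooth.contMDiff.contMDiffAt,
    by simp only [hline_zero, h.domChart.left_inv ha], fun t => ?_, ?_⟩
  · refine submersion_eq_of_fst_eq h (hr_target t) h.mem_codChart_source ?_
    rw [codChart_submersion h ha]
    simp [hw_fst]
  · have hsymm := (contMDiffAt_domChart_symm h ha_target).mdifferentiableAt (n := ∞) (by simp)
    rw [tmap_comp (E' := E) (0 : ℝ) (by rwa [hline_zero])
      hline.differentiableAt.mdifferentiableAt, tmap_eq_fderiv, hline_zero,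
      ContinuousLinearMap.comp_apply]
    have hcancel := tmap_comp_eq_id (E' := E) ((h.domChart.open_source.eventually_mem ha).mono
      fun b hb => h.domChart.left_inv hb) hsymm
      ((contMDiffAt_domChart h).mdifferentiableAt (by simp))
    exact (congrArg _ hline.deriv).trans (congrArg (fun l => l u) hcancel)

end Submersion

section Action

variable {E : Type*} [NormedAddCommGroup E] [NormedSpace ℝ E]
  {F : Type*} [NormedAddCommGroup F] [NormedSpace ℝ F]
  {D : Type*} [TopologicalSpace D] [ChartedSpace E D] [Group D]
  {G : Subgroup D} [ChartedSpace F (D ⧸ G)]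

/-- The infinitesimal dressing action `u ↦ ρ_S(u)_x` at `x`, as a linear map into the model
space. -/
noncomputable def rhoL (E F : Type*) [NormedAddCommGroup E] [NormedSpace ℝ E]
    [NormedAddCommGroup F] [NormedSpace ℝ F] {D : Type*}
    [TopologicalSpace D] [ChartedSpace E D] [Group D] {G : Subgroup D} [ChartedSpace F (D ⧸ G)]
    (x : D ⧸ G) : LieAlg E D →L[ℝ] F := tmap E F (fun b : D => b • x) 1

theorem mem_lieSub_of_tmap_mk_eq_zero
    (hp : Manifold.IsSubmersion 𝓘(ℝ, E) 𝓘(ℝ, F) ∞ (QuotientGroup.mk : D → D ⧸ G))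
    {u : LieAlg E D} (hu : tmap E F (QuotientGroup.mk : D → D ⧸ G) 1 u = 0) :
    u ∈ lieSub E G := by
  obtain ⟨γ, hγ, hγ_zero, hγ_fibre, hγ_deriv⟩ := exists_curve_in_fibre (hp.isSubmersionAt 1) hu
  refine Submodule.subset_span ⟨γ, hγ, hγ_zero, fun t => ?_, hγ_deriv⟩
  simpa using QuotientGroup.eq.1 (hγ_fibre t).symm

variable [LieGroup 𝓘(ℝ, E) ∞ D]

theorem contMDiff_dressing
    (hp : Manifold.IsSubmersion 𝓘(ℝ, E) 𝓘(ℝ, F) ∞ (QuotientGroup.mk : D → D ⧸ G)) :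
    ContMDiff (𝓘(ℝ, E).prod 𝓘(ℝ, F)) 𝓘(ℝ, F) ∞ fun q : D × (D ⧸ G) => q.1 • q.2 := by
  rintro ⟨b, x⟩
  obtain ⟨a, rfl⟩ := QuotientGroup.mk_surjective x
  obtain ⟨σ, hσ, hσp⟩ := exists_local_section (hp.isSubmersionAt a)
  have hlift : (fun q : D × (D ⧸ G) => q.1 • q.2) =ᶠ[𝓝 (b, (a : D ⧸ G))]
      fun q => QuotientGroup.mk (q.1 * σ q.2) := by
    filter_upwards [continuousAt_snd.eventually hσp] with q hq
    exact congrArg (q.1 • ·) hq.symm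
  refine ContMDiffAt.congr_of_eventuallyEq ?_ hlift
  exact hp.contMDiff.contMDiffAt.comp _ (contMDiffAt_fst.mul
    (ContMDiffAt.comp (b, (a : D ⧸ G)) hσ contMDiffAt_snd))

theorem contMDiff_dressing_left
    (hp : Manifold.IsSubmersion 𝓘(ℝ, E) 𝓘(ℝ, F) ∞ (QuotientGroup.mk : D → D ⧸ G)) (a : D) :
    ContMDiff 𝓘(ℝ, F) 𝓘(ℝ, F) ∞ fun x : D ⧸ G => a • x :=
  (contMDiff_dressing hp).comp (contMDiff_const.prodMk contMDiff_id)

theorem contMDiff_dressing_right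
    (hp : Manifold.IsSubmersion 𝓘(ℝ, E) 𝓘(ℝ, F) ∞ (QuotientGroup.mk : D → D ⧸ G)) (x : D ⧸ G) :
    ContMDiff 𝓘(ℝ, E) 𝓘(ℝ, F) ∞ fun a : D => a • x :=
  (contMDiff_dressing hp).comp (contMDiff_id.prodMk contMDiff_const)

theorem contMDiff_conj (a : D) : ContMDiff 𝓘(ℝ, E) 𝓘(ℝ, E) ∞ fun b : D => a * b * a⁻¹ :=
  (contMDiff_mul_right (I := 𝓘(ℝ, E)) (n := ∞)).comp contMDiff_mul_left

theorem tmap_mk_Ad_inv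
    (hp : Manifold.IsSubmersion 𝓘(ℝ, E) 𝓘(ℝ, F) ∞ (QuotientGroup.mk : D → D ⧸ G)) (a : D)
    (u : LieAlg E D) :
    tmap E F (QuotientGroup.mk : D → D ⧸ G) 1 (Ad a⁻¹ u) =
      tmap F F (fun x : D ⧸ G => a⁻¹ • x) (a : D ⧸ G) (rhoL E F (a : D ⧸ G) u) := by
  have hmk : (fun b : D => (QuotientGroup.mk (a⁻¹ * b * a⁻¹⁻¹) : D ⧸ G)) =
      fun b => a⁻¹ • (b • (a : D ⧸ G)) := by
    funext b
    change _ = (QuotientGroup.mk (a⁻¹ * (b * a)) : D ⧸ G)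
    congr 1; group
  have hconj := tmap_comp (g := (QuotientGroup.mk : D → D ⧸ G)) (E₂ := F) (1 : D)
    (hp.contMDiff.mdifferentiable (by simp) _)
    ((contMDiff_conj (E := E) a⁻¹).mdifferentiable (by simp) _)
  rw [hmk, tmap_comp (g := fun x : D ⧸ G => a⁻¹ • x) (E' := F) (1 : D)
    ((contMDiff_dressing_left hp a⁻¹).mdifferentiable (by simp) _)
    ((contMDiff_dressing_right hp (a : D ⧸ G)).mdifferentiable (by simp) _)] at hconj
  simp only [one_smul, mul_one, mul_inv_cancel] at hconj
  exact (congrArg (fun l => l u) hconj).symm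

/-- The kernel of `ρ_S` at `aG` is `Ad_a 𝔤`, which is isotropic together with `𝔤`. -/
theorem form_eq_zero_of_rho_eq_zero
    (hp : Manifold.IsSubmersion 𝓘(ℝ, E) 𝓘(ℝ, F) ∞ (QuotientGroup.mk : D → D ⧸ G))
    {B : LinearMap.BilinForm ℝ (LieAlg E D)}
    (hB_ad : ∀ (a : D) (u v : LieAlg E D), B (Ad a u) (Ad a v) = B u v)
    (hG_isotropic : IsIsotropic B (lieSub E G)) {x : D ⧸ G} {u v : LieAlg E D}
    (hu : rhoL E F x u = 0) (hv : rhoL E F x v = 0) : B u v = 0 := by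
  obtain ⟨a, rfl⟩ := QuotientGroup.mk_surjective x
  rw [← hB_ad a⁻¹ u v]
  refine hG_isotropic _ ?_ _ ?_ <;> refine mem_lieSub_of_tmap_mk_eq_zero hp ?_
  · rw [tmap_mk_Ad_inv hp, hu, map_zero]
  · rw [tmap_mk_Ad_inv hp, hv, map_zero]

end Action

section LocalGroup

variable {E : Type*} [NormedAddCommGroup E] [NormedSpace ℝ E]
  {F : Type*} [NormedAddCommGroup F] [NormedSpace ℝ F]
  {M : Type*} [TopologicalSpace M] [ChartedSpace E M]
  {D : Type*} [TopologicalSpace D] [ChartedSpace E D] [Group D]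
  {G : Subgroup D} [ChartedSpace F (D ⧸ G)]

local notation "κ" => extChartAt 𝓘(ℝ, E) (1 : D)

/-- The multiplication of `D` in the chart at `1`. -/
noncomputable def locMul (E D : Type*) [NormedAddCommGroup E] [NormedSpace ℝ E]
    [TopologicalSpace D] [ChartedSpace E D] [Group D] (q : E × E) : E :=
  extChartAt 𝓘(ℝ, E) (1 : D) ((extChartAt 𝓘(ℝ, E) (1 : D)).symm q.1 *
    (extChartAt 𝓘(ℝ, E) (1 : D)).symm q.2)

/-- The conjugation `(a, b) ↦ a b a⁻¹` of `D` in the chart at `1`. -/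
noncomputable def locConj (E D : Type*) [NormedAddCommGroup E] [NormedSpace ℝ E]
    [TopologicalSpace D] [ChartedSpace E D] [Group D] (q : E × E) : E :=
  extChartAt 𝓘(ℝ, E) (1 : D) ((extChartAt 𝓘(ℝ, E) (1 : D)).symm q.1 *
    (extChartAt 𝓘(ℝ, E) (1 : D)).symm q.2 * ((extChartAt 𝓘(ℝ, E) (1 : D)).symm q.1)⁻¹)

/-- The dressing action in the charts at `1 : D` and `x : D ⧸ G`. -/
noncomputable def locAct (E F : Type*) [NormedAddCommGroup E] [NormedSpace ℝ E]
    [NormedAddCommGroup F] [NormedSpace ℝ F] {D : Type*}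
    [TopologicalSpace D] [ChartedSpace E D] [Group D] {G : Subgroup D} [ChartedSpace F (D ⧸ G)]
    (x : D ⧸ G) (q : E × F) : F :=
  extChartAt 𝓘(ℝ, F) x ((extChartAt 𝓘(ℝ, E) (1 : D)).symm q.1 •
    (extChartAt 𝓘(ℝ, F) x).symm q.2)

theorem contMDiffAt_chart_symm_fst [IsManifold 𝓘(ℝ, E) ∞ M] (x : M) (y : F) :
    ContMDiffAt 𝓘(ℝ, E × F) 𝓘(ℝ, E) ∞ (fun q : E × F => (extChartAt 𝓘(ℝ, E) x).symm q.1)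
      (extChartAt 𝓘(ℝ, E) x x, y) :=
  ContMDiffAt.comp (f := Prod.fst) _
    (contMDiffAt_chart_symm (mem_extChartAt_target _)) contDiff_fst.contMDiff.contMDiffAt

theorem contMDiffAt_chart_symm_snd [IsManifold 𝓘(ℝ, E) ∞ M] (x : M) (y : F) :
    ContMDiffAt 𝓘(ℝ, F × E) 𝓘(ℝ, E) ∞ (fun q : F × E => (extChartAt 𝓘(ℝ, E) x).symm q.2)
      (y, extChartAt 𝓘(ℝ, E) x x) :=
  ContMDiffAt.comp (f := Prod.snd) _
    (contMDiffAt_chart_symm (mem_extChartAt_target _)) contDiff_snd.contMDiff.contMDiffAt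

theorem contDiffAt_two_chart_comp [IsManifold 𝓘(ℝ, E) ∞ M] {f : F → M} {x : M} {y : F}
    (hf : ContMDiffAt 𝓘(ℝ, F) 𝓘(ℝ, E) ∞ f y) (hy : f y = x) :
    ContDiffAt ℝ 2 (fun z => extChartAt 𝓘(ℝ, E) x (f z)) y := by
  subst hy
  have hcomp := (contMDiffAt_chart (mem_extChartAt_source (I := 𝓘(ℝ, E)) (f y))).comp y hf
  exact hcomp.contDiffAt.of_le (n := ∞) (WithTop.coe_le_coe.2 le_top)

theorem chart_symm_one : (κ).symm (κ 1) = 1 := extChartAt_to_inv _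

theorem locConj_one (a : E) : locConj E D (a, κ 1) = κ 1 := by
  rw [locConj, chart_symm_one, mul_one, mul_inv_cancel]

theorem locAct_one (x : D ⧸ G) :
    ∀ᶠ y in 𝓝 (extChartAt 𝓘(ℝ, F) x x), locAct E F x (κ 1, y) = y := by
  filter_upwards [extChartAt_target_mem_nhds (I := 𝓘(ℝ, F)) x] with y hy
  rw [locAct, chart_symm_one, one_smul, (extChartAt 𝓘(ℝ, F) x).right_inv hy]

variable [LieGroup 𝓘(ℝ, E) ∞ D]

theorem contMDiffAt_mul_chart_symm : ContMDiffAt 𝓘(ℝ, E × E) 𝓘(ℝ, E) ∞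
    (fun q : E × E => (κ).symm q.1 * (κ).symm q.2) (κ 1, κ 1) :=
  (contMDiffAt_chart_symm_fst (1 : D) _).mul (contMDiffAt_chart_symm_snd (1 : D) _)

theorem contMDiffAt_conj_chart_symm : ContMDiffAt 𝓘(ℝ, E × E) 𝓘(ℝ, E) ∞
    (fun q : E × E => (κ).symm q.1 * (κ).symm q.2 * ((κ).symm q.1)⁻¹) (κ 1, κ 1) :=
  contMDiffAt_mul_chart_symm.mul (contMDiffAt_chart_symm_fst (1 : D) _).inv

theorem isLocalMul_locMul : IsLocalMul (locMul E D) (κ 1) where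
  contDiffAt := contDiffAt_two_chart_comp contMDiffAt_mul_chart_symm
    (by simp only [chart_symm_one, mul_one])
  one_mul := by
    filter_upwards [extChartAt_target_mem_nhds (I := 𝓘(ℝ, E)) (1 : D)] with b hb
    rw [locMul, chart_symm_one, one_mul, (κ).right_inv hb]
  mul_one := by
    filter_upwards [extChartAt_target_mem_nhds (I := 𝓘(ℝ, E)) (1 : D)] with b hb
    rw [locMul, chart_symm_one, mul_one, (κ).right_inv hb]

theorem contDiffAt_locConj : ContDiffAt ℝ 2 (locConj E D) (κ 1, κ 1) :=
  contDiffAt_two_chart_comp contMDiffAt_conj_chart_symm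
    (by simp only [chart_symm_one, mul_one, inv_one])

theorem eventually_locMul_locConj :
    ∀ᶠ a in 𝓝 (κ 1), ∀ᶠ b in 𝓝 (κ 1),
      locMul E D (locConj E D (a, b), a) = locMul E D (a, b) := by
  have hsource : ∀ᶠ q in 𝓝 (κ 1, κ 1),
      (κ).symm q.1 * (κ).symm q.2 * ((κ).symm q.1)⁻¹ ∈ (κ).source :=
    contMDiffAt_conj_chart_symm.continuousAt.eventually ((isOpen_extChartAt_source (1 : D)).mem_nhds
      (by simp only [chart_symm_one, mul_one, inv_one, mem_extChartAt_source]))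
  filter_upwards [hsource.curry_nhds] with a ha
  filter_upwards [ha] with b hb
  simp only [locMul, locConj, (κ).left_inv hb, inv_mul_cancel_right]

theorem generator_locMul (u : E) {z : E} (hz : z ∈ (κ).target) :
    generator (locMul E D) (κ 1) u z =
      tmap E E κ ((κ).symm z) (tmap E E (fun b : D => b * (κ).symm z) 1 u) := by
  have h := fderiv_inCharts_self (E := E) (E' := E) (x := (1 : D)) (y := (1 : D))
    (f := fun b => b * (κ).symm z)
    ((contMDiff_mul_right (I := 𝓘(ℝ, E)) (n := ∞)).mdifferentiable (by simp) 1)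
    (by rw [one_mul]; exact (κ).map_target hz)
  rw [one_mul] at h
  exact congrArg (fun l => l u) h

section Dressing

variable (hp : Manifold.IsSubmersion 𝓘(ℝ, E) 𝓘(ℝ, F) ∞ (QuotientGroup.mk : D → D ⧸ G))
include hp

theorem eventually_locAct_locMul (x : D ⧸ G) :
    ∀ᶠ b in 𝓝 (κ 1), ∀ᶠ a in 𝓝 (κ 1),
      locAct E F x (locMul E D (a, b), extChartAt 𝓘(ℝ, F) x x) =
        locAct E F x (a, locAct E F x (b, extChartAt 𝓘(ℝ, F) x x)) := by
  have hmul : ∀ᶠ q in 𝓝 (κ 1, κ 1), (κ).symm q.2 * (κ).symm q.1 ∈ (κ).source :=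
    ((contMDiffAt_chart_symm_snd (1 : D) _).mul
      (contMDiffAt_chart_symm_fst (1 : D) _)).continuousAt.eventually
      ((isOpen_extChartAt_source (1 : D)).mem_nhds
        (by simp only [Pi.mul_apply, chart_symm_one, mul_one, mem_extChartAt_source]))
  have hact : ∀ᶠ b in 𝓝 (κ 1), (κ).symm b • x ∈ (extChartAt 𝓘(ℝ, F) x).source := by
    have hcont : ContinuousAt (fun b => (κ).symm b • x) (κ 1) :=
      (contMDiff_dressing_right hp x).continuous.continuousAt.comp
        (continuousAt_extChartAt_symm (1 : D))
    exact hcont.eventually ((isOpen_extChartAt_source x).mem_nhds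
      (by simp only [chart_symm_one, one_smul, mem_extChartAt_source]))
  filter_upwards [hmul.curry_nhds, hact] with b hb hb'
  filter_upwards [hb] with a ha
  simp only [locAct, locMul, (κ).left_inv ha, extChartAt_to_inv,
    (extChartAt 𝓘(ℝ, F) x).left_inv hb', mul_smul]

variable [IsManifold 𝓘(ℝ, F) ∞ (D ⧸ G)]

theorem contDiffAt_locAct (x : D ⧸ G) :
    ContDiffAt ℝ 2 (locAct E F x) (κ 1, extChartAt 𝓘(ℝ, F) x x) :=
  contDiffAt_two_chart_comp
    (ContMDiffAt.comp (g := fun q : D × (D ⧸ G) => q.1 • q.2) _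
      (contMDiff_dressing hp).contMDiffAt
      ((contMDiffAt_chart_symm_fst (1 : D) _).prodMk (contMDiffAt_chart_symm_snd x _)))
    (by simp only [extChartAt_to_inv, one_smul])

theorem generator_locAct (x : D ⧸ G) (u : LieAlg E D) {y : F}
    (hy : y ∈ (extChartAt 𝓘(ℝ, F) x).target) :
    generator (locAct E F x) (κ 1) u y =
      tmap F F (extChartAt 𝓘(ℝ, F) x) ((extChartAt 𝓘(ℝ, F) x).symm y)
        (rhoL E F ((extChartAt 𝓘(ℝ, F) x).symm y) u) := by
  have h := fderiv_inCharts_self (E := E) (E' := F) (x := (1 : D)) (y := x)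
    (f := fun b => b • (extChartAt 𝓘(ℝ, F) x).symm y)
    ((contMDiff_dressing_right hp _).mdifferentiable (by simp) 1)
    (by rw [one_smul]; exact (extChartAt 𝓘(ℝ, F) x).map_target hy)
  rw [one_smul] at h
  exact congrArg (fun l => l u) h

theorem generator_locAct_self (x : D ⧸ G) (u : LieAlg E D) :
    generator (locAct E F x) (κ 1) u (extChartAt 𝓘(ℝ, F) x x) = rhoL E F x u := by
  rw [generator_locAct hp x u (mem_extChartAt_target x), extChartAt_to_inv, tmap_chart_self]
  rfl

end Dressing

theorem inverse_tmap_chart_symm [IsManifold 𝓘(ℝ, E) ∞ M] {x : M} {z : E}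
    (hz : z ∈ (extChartAt 𝓘(ℝ, E) x).target) :
    (tmap E E (extChartAt 𝓘(ℝ, E) x).symm z).inverse =
      tmap E E (extChartAt 𝓘(ℝ, E) x) ((extChartAt 𝓘(ℝ, E) x).symm z) := by
  refine ContinuousLinearMap.inverse_eq ?_ (tmap_chart_comp_symm hz)
  simpa only [(extChartAt 𝓘(ℝ, E) x).right_inv hz] using
    tmap_symm_comp_chart ((extChartAt 𝓘(ℝ, E) x).map_target hz)

theorem mlieBracket_eq_lieBracket [IsManifold 𝓘(ℝ, E) ∞ M] {x : M}
    {X Y : ∀ p : M, TangentSpace 𝓘(ℝ, E) p} {X₀ Y₀ : E → E}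
    (hX : ∀ᶠ z in 𝓝 (extChartAt 𝓘(ℝ, E) x x),
      tmap E E (extChartAt 𝓘(ℝ, E) x) ((extChartAt 𝓘(ℝ, E) x).symm z)
        (X ((extChartAt 𝓘(ℝ, E) x).symm z)) = X₀ z)
    (hY : ∀ᶠ z in 𝓝 (extChartAt 𝓘(ℝ, E) x x),
      tmap E E (extChartAt 𝓘(ℝ, E) x) ((extChartAt 𝓘(ℝ, E) x).symm z)
        (Y ((extChartAt 𝓘(ℝ, E) x).symm z)) = Y₀ z) :
    (VectorField.mlieBracket 𝓘(ℝ, E) X Y x : E) =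
      VectorField.lieBracket ℝ X₀ Y₀ (extChartAt 𝓘(ℝ, E) x x) := by
  let pulled (Z : ∀ p : M, TangentSpace 𝓘(ℝ, E) p) (z : E) : E :=
    (mfderivWithin 𝓘(ℝ, E) 𝓘(ℝ, E) (extChartAt 𝓘(ℝ, E) x).symm
      (Set.range 𝓘(ℝ, E)) z : E →L[ℝ] E).inverse (Z ((extChartAt 𝓘(ℝ, E) x).symm z))
  have hpulled {Z : ∀ p : M, TangentSpace 𝓘(ℝ, E) p} {Z₀ : E → E}
      (hZ : ∀ᶠ z in 𝓝 (extChartAt 𝓘(ℝ, E) x x),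
        tmap E E (extChartAt 𝓘(ℝ, E) x) ((extChartAt 𝓘(ℝ, E) x).symm z)
          (Z ((extChartAt 𝓘(ℝ, E) x).symm z)) = Z₀ z) :
      pulled Z =ᶠ[𝓝 (extChartAt 𝓘(ℝ, E) x x)] Z₀ := by
    filter_upwards [hZ, extChartAt_target_mem_nhds (I := 𝓘(ℝ, E)) x] with z hz hz'
    rw [← hz, ← inverse_tmap_chart_symm hz']
    simp only [pulled, modelWithCornersSelf_coe, Set.range_id, mfderivWithin_univ]
    rfl
  have hdef : (VectorField.mlieBracket 𝓘(ℝ, E) X Y x : E) =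
      (tmap E E (extChartAt 𝓘(ℝ, E) x) x).inverse (VectorField.lieBracketWithin ℝ (pulled X)
        (pulled Y) ((extChartAt 𝓘(ℝ, E) x).symm ⁻¹' Set.univ ∩ Set.range 𝓘(ℝ, E))
        (extChartAt 𝓘(ℝ, E) x x)) := rfl
  rw [hdef, tmap_chart_self, ContinuousLinearMap.inverse_id, Set.preimage_univ, Set.univ_inter,
    modelWithCornersSelf_coe, Set.range_id, VectorField.lieBracketWithin_univ,
    (hpulled hX).lieBracket_vectorField_eq (hpulled hY), ContinuousLinearMap.id_apply]

theorem lieFun_eq_lieBracket (u v : LieAlg E D) :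
    (lieFun u v : E) = VectorField.lieBracket ℝ (E := E) (generator (locMul E D) (κ 1) u)
      (generator (locMul E D) (κ 1) v) (κ 1) := by
  have hright (w : E) : ∀ᶠ z in 𝓝 (κ 1),
      tmap E E κ ((κ).symm z) (rightField (E := E) w ((κ).symm z)) =
        generator (locMul E D) (κ 1) w z := by
    filter_upwards [extChartAt_target_mem_nhds (I := 𝓘(ℝ, E)) (1 : D)] with z hz
    exact (generator_locMul w hz).symm
  exact mlieBracket_eq_lieBracket (hright u) (hright v)

end LocalGroup

section LieAlgebra

variable {E : Type*} [NormedAddCommGroup E] [NormedSpace ℝ E]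
  {D : Type*} [TopologicalSpace D] [ChartedSpace E D] [Group D]

local notation "κ" => extChartAt 𝓘(ℝ, E) (1 : D)

/-- The adjoint action `Ad_a`, as a continuous linear map. -/
noncomputable def AdL (a : D) : LieAlg E D →L[ℝ] LieAlg E D :=
  (tmap E E (fun b : D => a * b * a⁻¹) 1 : E →L[ℝ] E)

theorem AdL_apply (a : D) (u : LieAlg E D) : AdL a u = Ad a u := rfl

theorem Ad_one (u : LieAlg E D) : Ad (1 : D) u = u := by
  have hconj : (fun c : D => 1 * c * 1⁻¹) = fun c => c := by funext c; simp
  have h := tmap_id (E := E) (1 : D)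
  rw [← hconj] at h
  exact congrArg (fun l => l u) h

theorem eventually_Ad_chart (u : LieAlg E D) :
    (fun a : D => Ad ((κ).symm (κ a)) u) =ᶠ[𝓝 1] fun a => Ad a u := by
  filter_upwards [extChartAt_source_mem_nhds (I := 𝓘(ℝ, E)) (1 : D)] with a ha
  rw [(κ).left_inv ha]

variable [LieGroup 𝓘(ℝ, E) ∞ D]

theorem Ad_mul (a b : D) (u : LieAlg E D) : Ad (a * b) u = Ad a (Ad b u) := by
  have hconj : (fun c : D => a * b * c * (a * b)⁻¹) = fun c => a * (b * c * b⁻¹) * a⁻¹ := by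
    funext c; group
  have h := tmap_comp (g := fun c => a * c * a⁻¹) (E' := E) (E₂ := E) (1 : D)
    ((contMDiff_conj a).mdifferentiable (by simp) _)
    ((contMDiff_conj (E := E) b).mdifferentiable (by simp) _)
  rw [← hconj, mul_one, mul_inv_cancel] at h
  exact congrArg (fun l => l u) h

theorem fderiv_locConj (a : E) (u : LieAlg E D) :
    fderiv ℝ (fun b => locConj E D (a, b)) (κ 1) u = Ad ((κ).symm a) u := by
  have hone : (κ).symm a * 1 * ((κ).symm a)⁻¹ = 1 := by simp
  have h := fderiv_inCharts_self (E := E) (E' := E) (x := (1 : D)) (y := (1 : D))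
    (f := fun b => (κ).symm a * b * ((κ).symm a)⁻¹)
    ((contMDiff_conj _).mdifferentiable (by simp) 1)
    (by rw [hone]; exact mem_extChartAt_source _)
  rw [hone, tmap_chart_self] at h
  exact congrArg (fun l => l u) h

theorem hasFDerivAt_Ad_chart_symm (u : LieAlg E D) : ∃ A : E →L[ℝ] LieAlg E D,
    HasFDerivAt (fun z : E => Ad ((κ).symm z) u) A (κ 1) ∧ ∀ v, A v = lieFun u v := by
  have hAd := differentiableAt_fderiv_right (contDiffAt_locConj (E := E) (D := D)) u
  have hA (v : E) := (isLocalMul_locMul (E := E)).fderiv_fderiv_conj contDiffAt_locConj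
    (.of_forall (locConj_one (D := D))) eventually_locMul_locConj u v
  simp only [fderiv_locConj] at hAd hA
  exact ⟨_, hAd.hasFDerivAt, fun v => (hA v).trans (lieFun_eq_lieBracket u v).symm⟩

/-- The sign is that of the bracket of right-invariant vector fields: the derivative of
`a ↦ Ad_a u` at the unit is `v ↦ [u, v]`. -/
theorem hasMFDerivAt_Ad (u : LieAlg E D) :
    MDifferentiableAt 𝓘(ℝ, E) 𝓘(ℝ, LieAlg E D) (fun a : D => Ad a u) 1 ∧
      ∀ v, tmap E (LieAlg E D) (fun a : D => Ad a u) 1 v = lieFun u v := by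
  obtain ⟨A, hA, hA_apply⟩ := hasFDerivAt_Ad_chart_symm u
  have hAd := hA.differentiableAt.mdifferentiableAt
  have hκ := mdifferentiableAt_chart (mem_extChartAt_source (I := 𝓘(ℝ, E)) (1 : D))
  refine ⟨(hAd.comp 1 hκ).congr_of_eventuallyEq (eventually_Ad_chart u).symm, fun v => ?_⟩
  rw [← tmap_congr (eventually_Ad_chart u),
    tmap_comp (g := fun z => Ad ((κ).symm z) u) (E' := E) (1 : D) hAd hκ,
    tmap_eq_fderiv, hA.fderiv, tmap_chart_self]
  exact hA_apply v

theorem hasDerivAt_Ad_along {γ : ℝ → D} {v : LieAlg E D}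
    (hγ : MDifferentiableAt 𝓘(ℝ, ℝ) 𝓘(ℝ, E) γ 0) (hγ_zero : γ 0 = 1)
    (hγ_deriv : tmap ℝ E γ 0 1 = v) (u : LieAlg E D) :
    HasDerivAt (fun t => Ad (γ t) u) (lieFun u v) 0 := by
  obtain ⟨hAd, hAd_apply⟩ := hasMFDerivAt_Ad u
  rw [← hγ_zero] at hAd
  have hcomp := tmap_comp (0 : ℝ) hAd hγ
  rw [hγ_zero, tmap_eq_fderiv] at hcomp
  have h := (hAd.comp 0 hγ).differentiableAt.hasDerivAt
  have hderiv : deriv (fun t => Ad (γ t) u) 0 = lieFun u v :=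
    (congrArg (fun l => l 1) hcomp).trans <|
      (congrArg (tmap E (LieAlg E D) (fun a : D => Ad a u) 1) hγ_deriv).trans (hAd_apply v)
  rw [← hderiv]
  exact h

theorem exists_curve_through_one (u : E) :
    ∃ γ : ℝ → D, MDifferentiableAt 𝓘(ℝ, ℝ) 𝓘(ℝ, E) γ 0 ∧ γ 0 = 1 ∧ tmap ℝ E γ 0 1 = u := by
  let line : ℝ → E := fun t => κ 1 + t • u
  have hline : HasDerivAt line u 0 := by
    simpa only [one_smul, id_eq] using ((hasDerivAt_id (0 : ℝ)).smul_const u).const_add (κ 1)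
  have hline_zero : line 0 = κ 1 := by simp only [line, zero_smul, add_zero]
  have hκ := mdifferentiableAt_chart_symm (mem_extChartAt_target (I := 𝓘(ℝ, E)) (1 : D))
  rw [← hline_zero] at hκ
  refine ⟨fun t => (κ).symm (line t), hκ.comp 0 hline.differentiableAt.mdifferentiableAt,
    by simp only [hline_zero, chart_symm_one], ?_⟩
  rw [tmap_comp (E' := E) (0 : ℝ) hκ hline.differentiableAt.mdifferentiableAt, hline_zero,
    tmap_symm_self, tmap_eq_fderiv]
  exact hline.deriv

theorem lieFun_Ad (g : D) (u v : LieAlg E D) : lieFun (Ad g u) (Ad g v) = Ad g (lieFun u v) := by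
  obtain ⟨γ, hγ, hγ_zero, hγ_deriv⟩ := exists_curve_through_one (E := E) (D := D) v
  have hconj := (contMDiff_conj (E := E) g).mdifferentiable (by simp)
  have hconj_zero : g * γ 0 * g⁻¹ = 1 := by rw [hγ_zero, mul_one, mul_inv_cancel]
  have hconj_deriv : tmap ℝ E (fun t => g * γ t * g⁻¹) 0 1 = Ad g v := by
    rw [tmap_comp (g := fun b => g * b * g⁻¹) (E' := E) (0 : ℝ) (hconj _) hγ, hγ_zero]
    exact congrArg (tmap E E (fun b => g * b * g⁻¹) 1) hγ_deriv
  have hleft := hasDerivAt_Ad_along ((hconj _).comp 0 hγ) hconj_zero hconj_deriv (Ad g u)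
  have hright := (AdL g).hasFDerivAt.comp_hasDerivAt 0
    (hasDerivAt_Ad_along hγ hγ_zero hγ_deriv u)
  have heq : (fun t => Ad (g * γ t * g⁻¹) (Ad g u)) = fun t => AdL g (Ad (γ t) u) := by
    funext t
    rw [← Ad_mul, AdL_apply, ← Ad_mul, inv_mul_cancel_right]
  exact (heq ▸ hleft).unique hright

theorem lieGroup_minSmoothness : LieGroup 𝓘(ℝ, E) (minSmoothness ℝ 3) D := by
  refine LieGroup.of_le (n := ∞) ?_
  rw [minSmoothness_of_isRCLikeNormedField]
  exact WithTop.coe_le_coe.2 le_top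

variable [FiniteDimensional ℝ E]

theorem lie_apply (u v : LieAlg E D) : lie E D u v = lieFun u v := rfl

theorem lie_Ad (g : D) (u v : LieAlg E D) : lie E D (Ad g u) (Ad g v) = Ad g (lie E D u v) :=
  lieFun_Ad g u v

theorem lie_antisymm (u v : LieAlg E D) : lie E D u v = -lie E D v u := by
  have := lieGroup_minSmoothness (E := E) (D := D)
  refine toTangent.injective ?_
  rw [lie_apply, lie_apply, map_neg, lieFun_eq, lieFun_eq, neg_neg, ← lie_skew, neg_neg]

theorem lie_jacobi_cyclic (u v w : LieAlg E D) :
    lie E D (lie E D u v) w + lie E D (lie E D v w) u + lie E D (lie E D w u) v = 0 := by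
  have := lieGroup_minSmoothness (E := E) (D := D)
  refine toTangent.injective ?_
  simp only [lie_apply, map_add, lieFun_eq, map_zero, neg_lie, neg_neg]
  rw [← neg_eq_zero, neg_add, neg_add, lie_skew, lie_skew, lie_skew, add_comm, ← add_assoc]
  exact lie_jacobi _ _ _

theorem form_lie_left {B : LinearMap.BilinForm ℝ (LieAlg E D)}
    (hB_ad : ∀ (a : D) (u v : LieAlg E D), B (Ad a u) (Ad a v) = B u v) (u v w : LieAlg E D) :
    B (lie E D u v) w = -B v (lie E D u w) := by
  obtain ⟨γ, hγ, hγ_zero, hγ_deriv⟩ := exists_curve_through_one (E := E) (D := D) u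
  have hAd := hasDerivAt_Ad_along hγ hγ_zero hγ_deriv
  have hderiv := ((LinearMap.toContinuousBilinearMap B).hasFDerivAt.comp_hasDerivAt 0
    (hAd v)).clm_apply (hAd w)
  have hconst : (fun t => LinearMap.toContinuousBilinearMap B (Ad (γ t) v) (Ad (γ t) w)) =
      fun _ => B v w := funext fun t => hB_ad (γ t) v w
  have h : B (lieFun v u) w + B v (lieFun w u) = 0 := by
    have hzero := (hconst ▸ hderiv : HasDerivAt (fun _ : ℝ => B v w) _ 0).unique
      (hasDerivAt_const _ _)
    simpa only [hγ_zero, Ad_one, Function.comp_apply,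
      LinearMap.toContinuousBilinearMap_apply] using hzero
  rw [← lie_apply, ← lie_apply, lie_antisymm v, lie_antisymm w, map_neg, map_neg,
    LinearMap.neg_apply] at h
  linarith

end LieAlgebra

section Curvature

variable {E : Type*} [NormedAddCommGroup E] [NormedSpace ℝ E]
  {F : Type*} [NormedAddCommGroup F] [NormedSpace ℝ F]
  {V : Type*} [NormedAddCommGroup V] [NormedSpace ℝ V]

/-- The value on `X, Y` of the exterior derivative of a one-form whose derivative at the point
is `d`. -/
noncomputable def curl (d : F →L[ℝ] F →L[ℝ] V) (X Y : F) : V := d X Y - d Y X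

/-- The curvature `δ + ½[a, a]` of a one-form with value `a` and exterior derivative `δ` at a
point, for the bracket `L`. -/
noncomputable def curv (L : V →L[ℝ] V →L[ℝ] V) (a : F →L[ℝ] V) (δ : F → F → V) (X Y : F) : V :=
  δ X Y + L (a X) (a Y)

theorem fderiv_generator_add_generator_fderiv {Φ : E × F → F} {e : E} {y : F} {s : F → F →L[ℝ] E}
    (hΦ : ContDiffAt ℝ 2 Φ (e, y)) (hs : DifferentiableAt ℝ s y)
    (hsplit : ∀ᶠ z in 𝓝 y, ∀ X, generator Φ e (s z X) z = X) (X Y : F) :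
    fderiv ℝ (generator Φ e (s y Y)) y X + generator Φ e (fderiv ℝ s y X Y) y = 0 := by
  have hderiv := (hasFDerivAt_fderiv_right hΦ).clm_apply
    ((hs.hasFDerivAt.clm_apply (hasFDerivAt_const Y y)).prodMk (hasFDerivAt_const (0 : F) y))
  have hconst : (fun z => fderiv ℝ Φ (e, z) (s z Y, 0)) =ᶠ[𝓝 y] fun _ => Y := by
    filter_upwards [hsplit, eventually_differentiableAt_right hΦ] with z hz hΦz
    rw [← fderiv_prodMk_left_apply hΦz]
    exact hz Y
  have hzero := DFunLike.congr_fun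
    (hderiv.unique ((hasFDerivAt_const Y y).congr_of_eventuallyEq hconst)) X
  rw [fderiv_generator_apply hΦ, generator_eq hΦ]
  simpa [add_comm] using hzero

theorem generator_curvature {Φ : E × F → F} {e : E} {y : F} {s : F → F →L[ℝ] E}
    (hΦ : ContDiffAt ℝ 2 Φ (e, y)) (hs : DifferentiableAt ℝ s y)
    (hsplit : ∀ᶠ z in 𝓝 y, ∀ X, generator Φ e (s z X) z = X) (X Y : F) :
    generator Φ e (curl (fderiv ℝ s y) X Y) y +
      VectorField.lieBracket ℝ (generator Φ e (s y X)) (generator Φ e (s y Y)) y = 0 := by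
  have hsub (u v : E) : generator Φ e (u - v) y = generator Φ e u y - generator Φ e v y := by
    rw [generator_eq hΦ, generator_eq hΦ, generator_eq hΦ, ← map_sub, Prod.mk_sub_mk, sub_zero]
  have hderiv (X Y : F) := eq_neg_of_add_eq_zero_left
    (fderiv_generator_add_generator_fderiv hΦ hs hsplit X Y)
  rw [VectorField.lieBracket, hsplit.self_of_nhds X, hsplit.self_of_nhds Y, hderiv, hderiv, curl,
    hsub]
  abel

end Curvature

section ChernSimons

variable {F : Type*} [NormedAddCommGroup F] [NormedSpace ℝ F]
  {V : Type*} [NormedAddCommGroup V] [NormedSpace ℝ V]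

/-- `L` is a Lie bracket on `V` and `B` is an invariant symmetric bilinear form for it. -/
structure IsQuadraticBracket (B : V →L[ℝ] V →L[ℝ] ℝ) (L : V →L[ℝ] V →L[ℝ] V) : Prop where
  symm : ∀ u v, B u v = B v u
  assoc : ∀ u v w, B (L u v) w = B u (L v w)
  skew : ∀ u v, L u v = -L v u
  jacobi : ∀ u v w, L (L u v) w + L (L v w) u + L (L w u) v = 0

/-- The Chern–Simons three-form `½⟨δ, a⟩ + ⅙⟨[a, a], a⟩` of a one-form with value `a` and
exterior derivative `δ` at a point. -/
noncomputable def csForm (B : V →L[ℝ] V →L[ℝ] ℝ) (L : V →L[ℝ] V →L[ℝ] V) (a : F →L[ℝ] V)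
    (δ : F → F → V) (X Y Z : F) : ℝ :=
  1 / 2 * (B (δ X Y) (a Z) + B (δ Y Z) (a X) + B (δ Z X) (a Y)) + B (L (a X) (a Y)) (a Z)

/-- The derivative along `W` of the Chern–Simons form of a one-form with value `a`, derivative `d`
and second derivative `c` at a point. -/
noncomputable def csFormDeriv (B : V →L[ℝ] V →L[ℝ] ℝ) (L : V →L[ℝ] V →L[ℝ] V) (a : F →L[ℝ] V)
    (d : F →L[ℝ] F →L[ℝ] V) (c : F →L[ℝ] F →L[ℝ] F →L[ℝ] V) (W X Y Z : F) : ℝ :=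
  1 / 2 * (B (curl (c W) X Y) (a Z) + B (curl (c W) Y Z) (a X) + B (curl (c W) Z X) (a Y)) +
    (B ((1 / 2 : ℝ) • curl d X Y + L (a X) (a Y)) (d W Z) +
      B ((1 / 2 : ℝ) • curl d Y Z + L (a Y) (a Z)) (d W X) +
      B ((1 / 2 : ℝ) • curl d Z X + L (a Z) (a X)) (d W Y))

theorem curl_swap (d : F →L[ℝ] F →L[ℝ] V) (X Y : F) : curl d Y X = -curl d X Y :=
  (neg_sub _ _).symm

theorem curl_bianchi {c : F →L[ℝ] F →L[ℝ] F →L[ℝ] V} (hc : ∀ X Y, c X Y = c Y X) (X Y Z : F) :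
    curl (c X) Y Z + curl (c Y) Z X + curl (c Z) X Y = 0 := by
  simp only [curl, hc Y X, hc Z X, hc Z Y]
  abel

theorem contDiffOn_csForm {T : Set F} (hT : IsOpen T) {s : F → F →L[ℝ] V}
    (hs : ContDiffOn ℝ ∞ s T) (B : V →L[ℝ] V →L[ℝ] ℝ) (L : V →L[ℝ] V →L[ℝ] V) (X Y Z : F) :
    ContDiffOn ℝ ∞ (fun y => csForm B L (s y) (curl (fderiv ℝ s y)) X Y Z) T := by
  have hvalue (X : F) : ContDiffOn ℝ ∞ (fun y => s y X) T := hs.clm_apply contDiffOn_const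
  have hderiv (X Y : F) : ContDiffOn ℝ ∞ (fun y => fderiv ℝ s y X Y) T :=
    ((hs.fderiv_of_isOpen hT (m := ∞) (by simp)).clm_apply contDiffOn_const).clm_apply
      contDiffOn_const
  have hcurl (X Y : F) : ContDiffOn ℝ ∞ (fun y => curl (fderiv ℝ s y) X Y) T :=
    (hderiv X Y).sub (hderiv Y X)
  have hform {f g : F → V} (hf : ContDiffOn ℝ ∞ f T) (hg : ContDiffOn ℝ ∞ g T) :
      ContDiffOn ℝ ∞ (fun y => B (f y) (g y)) T := (B.contDiff.comp_contDiffOn hf).clm_apply hg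
  have hbracket (X Y : F) : ContDiffOn ℝ ∞ (fun y => L (s y X) (s y Y)) T :=
    (L.contDiff.comp_contDiffOn (hvalue X)).clm_apply (hvalue Y)
  exact (contDiffOn_const.mul (((hform (hcurl X Y) (hvalue Z)).add
    (hform (hcurl Y Z) (hvalue X))).add (hform (hcurl Z X) (hvalue Y)))).add
    (hform (hbracket X Y) (hvalue Z))

namespace IsQuadraticBracket

variable {B : V →L[ℝ] V →L[ℝ] ℝ} {L : V →L[ℝ] V →L[ℝ] V} (hBL : IsQuadraticBracket B L)

include hBL

theorem rotate (u v w : V) : B (L u v) w = B (L v w) u := by rw [hBL.assoc, hBL.symm]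

theorem form_jacobi (a b c d : V) :
    B (L a b) (L c d) - B (L a c) (L b d) + B (L a d) (L b c) = 0 := by
  have h := congrArg (fun w => B w d) (hBL.jacobi a b c)
  simp only [map_add, add_apply, map_zero, zero_apply, hBL.assoc (L _ _)] at h
  rw [hBL.skew c a, map_neg, neg_apply, hBL.symm (L b c)] at h
  linarith

theorem fderiv_csForm {s : F → F →L[ℝ] V} {y : F} (hs : ContDiffAt ℝ 2 s y) (W X Y Z : F) :
    fderiv ℝ (fun z => csForm B L (s z) (curl (fderiv ℝ s z)) X Y Z) y W =
      csFormDeriv B L (s y) (fderiv ℝ s y) (fderiv ℝ (fderiv ℝ s) y) W X Y Z := by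
  have hvalue (X : F) : HasFDerivAt (fun z => s z X) ((fderiv ℝ s y).flip X) y := by
    simpa using (hs.differentiableAt (by simp)).hasFDerivAt.clm_apply (hasFDerivAt_const X y)
  have hderiv (X Y : F) : HasFDerivAt (fun z => fderiv ℝ s z X Y)
      (((fderiv ℝ (fderiv ℝ s) y).flip X).flip Y) y := by
    simpa using ((hasFDerivAt_fderiv hs).clm_apply (hasFDerivAt_const X y)).clm_apply
      (hasFDerivAt_const Y y)
  have hcurl (X Y Z : F) :=
    (B.hasFDerivAt.comp y ((hderiv X Y).sub (hderiv Y X))).clm_apply (hvalue Z)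
  have hbracket := (B.hasFDerivAt.comp y
    ((L.hasFDerivAt.comp y (hvalue X)).clm_apply (hvalue Y))).clm_apply (hvalue Z)
  have hcs : HasFDerivAt (fun z => csForm B L (s z) (curl (fderiv ℝ s z)) X Y Z) _ y :=
    ((((hcurl X Y Z).add (hcurl Y Z X)).add (hcurl Z X Y)).const_mul (1 / 2)).add hbracket
  have hfirst := hBL.rotate (fderiv ℝ s y W X) (s y Y) (s y Z)
  have hsecond := hBL.rotate (s y Z) (s y X) (fderiv ℝ s y W Y)
  rw [hcs.fderiv]
  simp only [csFormDeriv, curl, hfirst, hsecond, one_div, Function.comp_apply, Pi.sub_apply,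
    ContinuousLinearMap.sub_comp, ContinuousLinearMap.comp_sub, ContinuousLinearMap.comp_add,
    ContinuousLinearMap.flip_add, ContinuousLinearMap.comp_apply, ContinuousLinearMap.flip_apply,
    map_add, map_sub, map_smul, add_apply, sub_apply, smul_apply, smul_add, smul_eq_mul]
  ring

theorem csForm_closed (a : F →L[ℝ] V) (d : F →L[ℝ] F →L[ℝ] V) {c : F →L[ℝ] F →L[ℝ] F →L[ℝ] V}
    (hc : ∀ X Y, c X Y = c Y X) (X₀ X₁ X₂ X₃ : F) :
    csFormDeriv B L a d c X₀ X₁ X₂ X₃ - csFormDeriv B L a d c X₁ X₀ X₂ X₃ +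
      csFormDeriv B L a d c X₂ X₀ X₁ X₃ - csFormDeriv B L a d c X₃ X₀ X₁ X₂ =
    B (curv L a (curl d) X₀ X₁) (curv L a (curl d) X₂ X₃) -
      B (curv L a (curl d) X₀ X₂) (curv L a (curl d) X₁ X₃) +
      B (curv L a (curl d) X₀ X₃) (curv L a (curl d) X₁ X₂) := by
  set u : F → F → V := fun X Y => (1 / 2 : ℝ) • curl d X Y + L (a X) (a Y) with hu
  have hu_swap (X Y : F) : u Y X = -u X Y := by
    simp only [hu, curl_swap d X Y, hBL.skew (a Y), smul_neg, neg_add]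
  have hu_curl (w : V) (X Y : F) : B w (d X Y) - B w (d Y X) = B w (curl d X Y) :=
    (map_sub (B w) _ _).symm
  have hbianchi (X Y Z W : F) : B (curl (c X) Y Z) (a W) + B (curl (c Y) Z X) (a W) +
      B (curl (c Z) X Y) (a W) = 0 := by
    simpa using congrArg (fun w => B w (a W)) (curl_bianchi hc X Y Z)
  have hderiv (W X Y Z : F) : csFormDeriv B L a d c W X Y Z =
      1 / 2 * (B (curl (c W) X Y) (a Z) + B (curl (c W) Y Z) (a X) + B (curl (c W) Z X) (a Y)) +
        (B (u X Y) (d W Z) + B (u Y Z) (d W X) + B (u Z X) (d W Y)) := rfl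
  have halternating : csFormDeriv B L a d c X₀ X₁ X₂ X₃ - csFormDeriv B L a d c X₁ X₀ X₂ X₃ +
      csFormDeriv B L a d c X₂ X₀ X₁ X₃ - csFormDeriv B L a d c X₃ X₀ X₁ X₂ =
      B (u X₀ X₁) (curl d X₂ X₃) + B (u X₂ X₃) (curl d X₀ X₁) - B (u X₀ X₂) (curl d X₁ X₃) -
        B (u X₁ X₃) (curl d X₀ X₂) + B (u X₀ X₃) (curl d X₁ X₂) + B (u X₁ X₂) (curl d X₀ X₃) := by
    simp only [hderiv, ← hu_curl, hu_swap X₀ X₂, hu_swap X₀ X₃, hu_swap X₁ X₃, curl_swap _ X₀ X₂,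
      curl_swap _ X₀ X₃, curl_swap _ X₁ X₃, map_neg, neg_apply]
    have h₀₁₂ := hbianchi X₀ X₁ X₂ X₃
    have h₀₁₃ := hbianchi X₀ X₁ X₃ X₂
    have h₀₂₃ := hbianchi X₀ X₂ X₃ X₁
    have h₁₂₃ := hbianchi X₁ X₂ X₃ X₀
    simp only [curl_swap _ X₀ X₂, curl_swap _ X₀ X₃, curl_swap _ X₁ X₃, map_neg, neg_apply]
      at h₀₁₂ h₀₁₃ h₀₂₃ h₁₂₃
    linear_combination (1 / 2) * (h₀₁₂ - h₀₁₃ + h₀₂₃ - h₁₂₃)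
  have hsymm (X Y Z W : F) := hBL.symm (curl d X Y) (curl d Z W)
  have hmixed (X Y Z W : F) := hBL.symm (curl d X Y) (L (a Z) (a W))
  rw [halternating]
  simp only [hu, curv, map_add, map_smul, add_apply, smul_apply, smul_eq_mul, hmixed]
  linear_combination (1 / 2) * (hsymm X₂ X₃ X₀ X₁ - hsymm X₁ X₃ X₀ X₂ + hsymm X₁ X₂ X₀ X₃) -
    hBL.form_jacobi (a X₀) (a X₁) (a X₂) (a X₃)

theorem csForm_generator {a : F →L[ℝ] V} {d : F →L[ℝ] F →L[ℝ] V}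
    (hd : ∀ W X Y, B (d W X) (a Y) = -B (d W Y) (a X)) {R X Y : F} {v : V}
    (hv : B (d R X) (a Y) = B (L (a X) v) (a Y))
    (hc : B (curv L a (curl d) X Y) (a R) = B (curv L a (curl d) X Y) v) :
    csForm B L a (curl d) R X Y = B (curl d X Y) v := by
  have hbracket := hBL.rotate (a R) (a X) (a Y)
  rw [hBL.skew (a X) v, map_neg, neg_apply, hBL.rotate] at hv
  have hRXY := hd R X Y
  have hXRY := hd X R Y
  have hYRX := hd Y R X
  simp only [curv, curl, map_add, map_sub, add_apply, sub_apply] at hc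
  simp only [csForm, curl, map_sub, sub_apply]
  linarith

end IsQuadraticBracket

end ChernSimons

section Wedge

variable {F : Type*} [NormedAddCommGroup F] [NormedSpace ℝ F]
  {S : Type*} [TopologicalSpace S] [ChartedSpace F S]
  {V : Type*} [NormedAddCommGroup V] [NormedSpace ℝ V]
  {W : Type*} [NormedAddCommGroup W] [NormedSpace ℝ W]
  {U : Type*} [NormedAddCommGroup U] [NormedSpace ℝ U]

theorem wedge_toModel_apply (B : V →L[ℝ] W →L[ℝ] U) {k l : ℕ} (α : FormField F S k V)
    (β : FormField F S l W) (x : S) (v : Fin (k + l) → F) :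
    (wedge B α β).toModel x v = ((k.factorial * l.factorial : ℝ)⁻¹) •
      ∑ τ : Equiv.Perm (Fin (k + l)), Equiv.Perm.sign τ •
        B (α.toModel x fun i => v (τ (Fin.castAdd l i)))
          (β.toModel x fun i => v (τ (Fin.natAdd k i))) :=
  congrArg (fun z : U => ((k.factorial * l.factorial : ℝ)⁻¹) • z)
    (ContinuousMultilinearMap.alternatization_apply_apply (tensorMap B (α x) (β x)) v)

theorem toModel_swap (α : FormField F S 2 V) (x : S) (X Y : F) :
    α.toModel x ![Y, X] = -α.toModel x ![X, Y] := by
  have hswap : ![X, Y] ∘ Equiv.swap (0 : Fin 2) 1 = ![Y, X] := by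
    ext i; fin_cases i <;> rfl
  rw [← hswap]
  exact (α.toModel x).toAlternatingMap.map_swap ![X, Y] (by decide)

theorem wedge_one_one (B : V →L[ℝ] W →L[ℝ] U) (α : FormField F S 1 V) (β : FormField F S 1 W)
    (x : S) (v : Fin 2 → F) : (wedge B α β).toModel x v =
      B (α.toModel x ![v 0]) (β.toModel x ![v 1]) -
        B (α.toModel x ![v 1]) (β.toModel x ![v 0]) := by
  have huniv : (Finset.univ : Finset (Equiv.Perm (Fin 2))) = {1, Equiv.swap 0 1} := by decide
  have hcons (z : Fin 1 → F) : z = ![z 0] := List.ofFn_inj.mp rfl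
  rw [wedge_toModel_apply, huniv, Finset.sum_pair (by decide)]
  simp only [hcons fun _ : Fin 1 => v _]
  simp [sub_eq_add_neg]

theorem wedge_two_one (B : V →L[ℝ] W →L[ℝ] U) (α : FormField F S 2 V) (β : FormField F S 1 W)
    (x : S) (v : Fin 3 → F) : (wedge B α β).toModel x v =
      B (α.toModel x ![v 0, v 1]) (β.toModel x ![v 2]) +
        B (α.toModel x ![v 1, v 2]) (β.toModel x ![v 0]) +
        B (α.toModel x ![v 2, v 0]) (β.toModel x ![v 1]) := by
  have huniv : (Finset.univ : Finset (Equiv.Perm (Fin 3))) =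
      {1, Equiv.swap 0 1, Equiv.swap 0 2, Equiv.swap 1 2, Equiv.swap 0 1 * Equiv.swap 1 2,
        Equiv.swap 1 2 * Equiv.swap 0 1} := by decide
  have hcons₁ (z : Fin 1 → F) : z = ![z 0] := List.ofFn_inj.mp rfl
  have hcons₂ (z : Fin 2 → F) : z = ![z 0, z 1] := List.ofFn_inj.mp rfl
  have hswap₁₂ : Equiv.swap (0 : Fin 3) 1 2 = 2 := by decide
  have hswap₂₁ : Equiv.swap (0 : Fin 3) 2 1 = 1 := by decide
  have hswap₂₀ : Equiv.swap (1 : Fin 3) 2 0 = 0 := by decide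
  rw [wedge_toModel_apply, huniv]
  repeat rw [Finset.sum_insert (by decide)]
  rw [Finset.sum_singleton]
  simp only [hcons₁ fun _ : Fin 1 => v _, hcons₂ fun _ : Fin 2 => v _]
  simp only [Nat.factorial_two, Nat.cast_ofNat, Nat.factorial_one, Nat.cast_one, mul_one,
    Nat.reduceAdd, Equiv.Perm.sign_one, Nat.succ_eq_add_one, Fin.isValue, Fin.reduceCastAdd,
    Equiv.Perm.coe_one, id_eq, Fin.reduceNatAdd, one_smul, Equiv.Perm.sign_swap', zero_ne_one,
    ↓reduceIte, Equiv.swap_apply_left, Equiv.swap_apply_right, toModel_swap α x (v 0) (v 1),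
    map_neg, hswap₁₂, neg_apply, smul_neg, Units.neg_smul, neg_neg, Fin.reduceEq, hswap₂₁,
    toModel_swap α x (v 1) (v 2), hswap₂₀, Equiv.Perm.sign_mul, mul_neg, Equiv.Perm.coe_mul,
    Function.comp_apply, toModel_swap α x (v 0) (v 2), smul_add]
  module

end Wedge

section OneForms

variable {F : Type*} [NormedAddCommGroup F] [NormedSpace ℝ F]
  {S : Type*} [TopologicalSpace S] [ChartedSpace F S]
  {V : Type*} [NormedAddCommGroup V] [NormedSpace ℝ V]

/-- The value of a one-form at `x`, as a map on the model space. -/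
def covectorAt (a : ∀ x : S, TangentSpace 𝓘(ℝ, F) x →L[ℝ] V) (x : S) : F →L[ℝ] V := a x

/-- The expression of a one-form in the chart at `x`. -/
noncomputable def covectorInChart (a : ∀ x : S, TangentSpace 𝓘(ℝ, F) x →L[ℝ] V) (x : S) (y : F) :
    F →L[ℝ] V :=
  (covectorAt a ((extChartAt 𝓘(ℝ, F) x).symm y)).comp (tmap F F (extChartAt 𝓘(ℝ, F) x).symm y)

/-- The derivative at `x` of the expression of a one-form in the chart at `x`. -/
noncomputable def covectorDeriv (a : ∀ x : S, TangentSpace 𝓘(ℝ, F) x →L[ℝ] V) (x : S) :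
    F →L[ℝ] F →L[ℝ] V :=
  fderiv ℝ (covectorInChart a x) (extChartAt 𝓘(ℝ, F) x x)

theorem inChart_oneForm (a : ∀ x : S, TangentSpace 𝓘(ℝ, F) x →L[ℝ] V) (x : S) :
    inChart (oneForm a) x = fun y =>
      ContinuousAlternatingMap.ofSubsingletonLIE (𝕜 := ℝ) (E := F) (F := V) (0 : Fin 1)
        (covectorInChart a x y) := rfl

theorem isSmoothForm_oneForm {a : ∀ x : S, TangentSpace 𝓘(ℝ, F) x →L[ℝ] V} :
    IsSmoothForm (oneForm a) ↔
      ∀ x, ContDiffOn ℝ ∞ (covectorInChart a x) (extChartAt 𝓘(ℝ, F) x).target :=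
  forall_congr' fun x => by
    rw [inChart_oneForm]
    exact (ContinuousAlternatingMap.ofSubsingletonLIE (𝕜 := ℝ) (E := F) (F := V) (0 : Fin 1)
      |>.toContinuousLinearEquiv).comp_contDiffOn_iff

theorem contDiffAt_covectorInChart {a : ∀ x : S, TangentSpace 𝓘(ℝ, F) x →L[ℝ] V}
    (ha : IsSmoothForm (oneForm a)) {x : S} {y : F} (hy : y ∈ (extChartAt 𝓘(ℝ, F) x).target) :
    ContDiffAt ℝ ∞ (covectorInChart a x) y :=
  (isSmoothForm_oneForm.1 ha x).contDiffAt (extChartAt_target_mem_nhds' hy)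

theorem isSmoothForm_comp_oneForm {W : Type*} [NormedAddCommGroup W] [NormedSpace ℝ W]
    {a : ∀ x : S, TangentSpace 𝓘(ℝ, F) x →L[ℝ] V} (ha : IsSmoothForm (oneForm a)) (l : V →L[ℝ] W) :
    IsSmoothForm (oneForm fun x => l.comp (a x)) :=
  isSmoothForm_oneForm.2 fun x =>
    (contDiffOn_const (c := l)).clm_comp (isSmoothForm_oneForm.1 ha x)

theorem extDeriv_oneForm {a : ∀ x : S, TangentSpace 𝓘(ℝ, F) x →L[ℝ] V} {x : S} {y : F}
    (ha : DifferentiableAt ℝ (covectorInChart a x) y) (v : Fin 2 → F) :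
    extDeriv (inChart (oneForm a) x) y v =
      curl (fderiv ℝ (covectorInChart a x) y) (v 0) (v 1) := by
  have hdiff : DifferentiableAt ℝ (inChart (oneForm a) x) y := by
    rw [inChart_oneForm]
    exact (LinearIsometryEquiv.differentiable _).differentiableAt.comp y ha
  have hderiv (X Y : F) : fderiv ℝ (fun z => covectorInChart a x z X) y Y =
      fderiv ℝ (covectorInChart a x) y Y X := by
    simp [(ha.hasFDerivAt.clm_apply (hasFDerivAt_const X y)).fderiv]
  have hzero : (fun z => inChart (oneForm a) x z (Fin.removeNth 0 v)) =
    fun z => covectorInChart a x z (v 1) := rfl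
  have hone : (fun z => inChart (oneForm a) x z (Fin.removeNth 1 v)) =
    fun z => covectorInChart a x z (v 0) := rfl
  rw [extDeriv_apply hdiff, Fin.sum_univ_two, hzero, hone, hderiv, hderiv]
  simp [curl, sub_eq_add_neg]

theorem extDeriv_apply_three {η : F → F [⋀^Fin 3]→L[ℝ] V} {y : F} (hη : DifferentiableAt ℝ η y)
    (v : Fin 4 → F) : extDeriv η y v =
      fderiv ℝ (fun z => η z ![v 1, v 2, v 3]) y (v 0) -
        fderiv ℝ (fun z => η z ![v 0, v 2, v 3]) y (v 1) +
        fderiv ℝ (fun z => η z ![v 0, v 1, v 3]) y (v 2) -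
        fderiv ℝ (fun z => η z ![v 0, v 1, v 2]) y (v 3) := by
  have hzero : Fin.removeNth 0 v = ![v 1, v 2, v 3] := List.ofFn_inj.mp rfl
  have hone : Fin.removeNth 1 v = ![v 0, v 2, v 3] := List.ofFn_inj.mp rfl
  have htwo : Fin.removeNth 2 v = ![v 0, v 1, v 3] := List.ofFn_inj.mp rfl
  have hthree : Fin.removeNth 3 v = ![v 0, v 1, v 2] := List.ofFn_inj.mp rfl
  rw [extDeriv_apply hη, Fin.sum_univ_four, hzero, hone, htwo, hthree]
  simp [sub_eq_add_neg]

variable [IsManifold 𝓘(ℝ, F) ∞ S]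

theorem covectorInChart_tmap_chart (a : ∀ x : S, TangentSpace 𝓘(ℝ, F) x →L[ℝ] V) {x p : S}
    (hp : p ∈ (extChartAt 𝓘(ℝ, F) x).source) (X : F) :
    covectorInChart a x (extChartAt 𝓘(ℝ, F) x p) (tmap F F (extChartAt 𝓘(ℝ, F) x) p X) =
      covectorAt a p X := by
  rw [covectorInChart, (extChartAt 𝓘(ℝ, F) x).left_inv hp, ContinuousLinearMap.comp_apply]
  exact congrArg (covectorAt a p) (DFunLike.congr_fun (tmap_symm_comp_chart hp) X)

theorem covectorInChart_self (a : ∀ x : S, TangentSpace 𝓘(ℝ, F) x →L[ℝ] V) (x : S) :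
    covectorInChart a x (extChartAt 𝓘(ℝ, F) x x) = covectorAt a x := by
  rw [covectorInChart, extChartAt_to_inv, tmap_symm_self]
  rfl

theorem extD_oneForm_apply {a : ∀ x : S, TangentSpace 𝓘(ℝ, F) x →L[ℝ] V}
    (ha : IsSmoothForm (oneForm a)) (x : S) (v : Fin 2 → F) :
    (extD (oneForm a)).toModel x v = curl (covectorDeriv a x) (v 0) (v 1) := by
  rw [extD_toModel_apply, extDeriv_oneForm ((contDiffAt_covectorInChart ha
    (mem_extChartAt_target x)).differentiableAt (by simp)), covectorDeriv]

theorem extD_comp_oneForm_apply {W : Type*} [NormedAddCommGroup W] [NormedSpace ℝ W]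
    {a : ∀ x : S, TangentSpace 𝓘(ℝ, F) x →L[ℝ] V} (ha : IsSmoothForm (oneForm a)) (l : V →L[ℝ] W)
    (x : S) (v : Fin 2 → F) : (extD (oneForm fun x => l.comp (a x))).toModel x v =
      l ((extD (oneForm a)).toModel x v) := by
  have hderiv : HasFDerivAt (covectorInChart (fun x => l.comp (a x)) x) _
      (extChartAt 𝓘(ℝ, F) x x) :=
    (hasFDerivAt_const l _).clm_comp ((contDiffAt_covectorInChart ha
      (mem_extChartAt_target x)).differentiableAt (by simp)).hasFDerivAt
  rw [extD_oneForm_apply (isSmoothForm_comp_oneForm ha l), extD_oneForm_apply ha, covectorDeriv,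
    hderiv.fderiv]
  simp [curl, covectorDeriv]

end OneForms

section FormFields

variable {F : Type*} [NormedAddCommGroup F] [NormedSpace ℝ F]
  {S : Type*} [TopologicalSpace S] [ChartedSpace F S]
  {V : Type*} [NormedAddCommGroup V] [NormedSpace ℝ V] {k : ℕ}

theorem FormField.ext_toModel {η θ : FormField F S k V}
    (h : ∀ x v, η.toModel x v = θ.toModel x v) : η = θ :=
  funext fun x => ContinuousAlternatingMap.ext (h x)

theorem inChart_zero (x : S) : inChart (0 : FormField F S k V) x = 0 := rfl

theorem isSmoothForm_zero : IsSmoothForm (0 : FormField F S k V) := fun x => by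
  rw [inChart_zero]
  exact contDiffOn_const (c := 0)

theorem extD_zero : extD (0 : FormField F S k V) = 0 := by
  refine FormField.ext_toModel fun x v => ?_
  have hzero : extDeriv (inChart (0 : FormField F S k V) x) (extChartAt 𝓘(ℝ, F) x x) = 0 := by
    rw [inChart_zero, extDeriv, fderiv_zero]
    exact map_zero (ContinuousAlternatingMap.alternatizeUncurryFinCLM ℝ F V)
  exact DFunLike.congr_fun hzero _

end FormFields

section Moment

variable {E : Type*} [NormedAddCommGroup E] [NormedSpace ℝ E] [FiniteDimensional ℝ E]
  {F : Type*} [NormedAddCommGroup F] [NormedSpace ℝ F]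
  {D : Type*} [TopologicalSpace D] [ChartedSpace E D] [Group D]
  {G : Subgroup D} [ChartedSpace F (D ⧸ G)]
  {B : LinearMap.BilinForm ℝ (LieAlg E D)}
  {s : ∀ x : D ⧸ G, TangentSpace 𝓘(ℝ, F) x →L[ℝ] LieAlg E D}

theorem isSmoothForm_sigma (hs : IsSmoothForm (oneForm s)) (v : lieSub E G) :
    IsSmoothForm (sigma B s v) :=
  isSmoothForm_comp_oneForm hs ((LinearMap.toContinuousBilinearMap B).flip (v : LieAlg E D))

theorem extD_sigma_toModel_apply [IsManifold 𝓘(ℝ, F) ∞ (D ⧸ G)]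
    (hs : IsSmoothForm (oneForm s)) (v : lieSub E G) (x : D ⧸ G) (w : Fin 2 → F) :
    (extD (sigma B s v)).toModel x w = B (curl (covectorDeriv s x) (w 0) (w 1)) v := by
  rw [← extD_oneForm_apply hs]
  exact extD_comp_oneForm_apply hs ((LinearMap.toContinuousBilinearMap B).flip (v : LieAlg E D)) x w

end Moment

section ChernSimonsForm

variable {E : Type*} [NormedAddCommGroup E] [NormedSpace ℝ E] [FiniteDimensional ℝ E]
  {F : Type*} [NormedAddCommGroup F] [NormedSpace ℝ F]
  {D : Type*} [TopologicalSpace D] [ChartedSpace E D] [Group D] [LieGroup 𝓘(ℝ, E) ∞ D]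
  {G : Subgroup D} [ChartedSpace F (D ⧸ G)]
  {B : LinearMap.BilinForm ℝ (LieAlg E D)}
  {s : ∀ x : D ⧸ G, TangentSpace 𝓘(ℝ, F) x →L[ℝ] LieAlg E D}

theorem isQuadraticBracket_lie (hB_symm : ∀ u v, B u v = B v u)
    (hB_ad : ∀ (a : D) (u v : LieAlg E D), B (Ad a u) (Ad a v) = B u v) :
    IsQuadraticBracket (LinearMap.toContinuousBilinearMap B) (lie E D) where
  symm := hB_symm
  assoc u v w := by
    simp only [LinearMap.toContinuousBilinearMap_apply]
    rw [lie_antisymm, map_neg, LinearMap.neg_apply, form_lie_left hB_ad, neg_neg]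
  skew := lie_antisymm
  jacobi := lie_jacobi_cyclic

theorem phi_toModel_apply
    (hB : IsQuadraticBracket (LinearMap.toContinuousBilinearMap B) (lie E D))
    (x : D ⧸ G) (v : Fin 3 → F) : (phi B s).toModel x v =
      csForm (LinearMap.toContinuousBilinearMap B) (lie E D) (covectorAt s x)
        (fun X Y => (extD (oneForm s)).toModel x ![X, Y]) (v 0) (v 1) (v 2) := by
  have hdouble (u v w : LieAlg E D) :
      LinearMap.toContinuousBilinearMap B (lie E D u v - lie E D v u) w =
        2 * LinearMap.toContinuousBilinearMap B (lie E D u v) w := by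
    rw [lie_antisymm v u, sub_neg_eq_add, ← two_smul ℝ, map_smul, smul_apply, smul_eq_mul]
  have hphi : (phi B s).toModel x v =
      (1 / 2 : ℝ) * (wedge (LinearMap.toContinuousBilinearMap B) (extD (oneForm s))
        (oneForm s)).toModel x v +
      (1 / 6 : ℝ) * (wedge (LinearMap.toContinuousBilinearMap B)
        (wedge (lie E D) (oneForm s) (oneForm s)) (oneForm s)).toModel x v := rfl
  have hvalue (X : F) : (oneForm s).toModel x ![X] = covectorAt s x X := rfl
  have hrotate := hB.rotate (covectorAt s x (v 0)) (covectorAt s x (v 1)) (covectorAt s x (v 2))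
  have hrotate' := hB.rotate (covectorAt s x (v 2)) (covectorAt s x (v 0)) (covectorAt s x (v 1))
  rw [hphi, wedge_two_one, wedge_two_one, csForm]
  simp only [wedge_one_one, hvalue, Matrix.cons_val_zero, Matrix.cons_val_one, hdouble]
  rw [← hrotate, hrotate']
  ring

variable [IsManifold 𝓘(ℝ, F) ∞ (D ⧸ G)]

theorem inChart_phi (hB : IsQuadraticBracket (LinearMap.toContinuousBilinearMap B) (lie E D))
    (hs : IsSmoothForm (oneForm s)) {x : D ⧸ G} {y : F}
    (hy : y ∈ (extChartAt 𝓘(ℝ, F) x).target) (v : Fin 3 → F) :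
    inChart (phi B s) x y v = csForm (LinearMap.toContinuousBilinearMap B) (lie E D)
      (covectorInChart s x y) (curl (fderiv ℝ (covectorInChart s x) y)) (v 0) (v 1) (v 2) := by
  have hcurl (X Y : F) : (extD (oneForm s)).toModel ((extChartAt 𝓘(ℝ, F) x).symm y)
      ![tmap F F (extChartAt 𝓘(ℝ, F) x).symm y X, tmap F F (extChartAt 𝓘(ℝ, F) x).symm y Y] =
      curl (fderiv ℝ (covectorInChart s x) y) X Y := by
    have hpair : ![tmap F F (extChartAt 𝓘(ℝ, F) x).symm y X,
        tmap F F (extChartAt 𝓘(ℝ, F) x).symm y Y] =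
        fun i => tmap F F (extChartAt 𝓘(ℝ, F) x).symm y (![X, Y] i) := by
      ext i; fin_cases i <;> rfl
    rw [hpair, ← inChart_apply, inChart_extD hs hy,
      extDeriv_oneForm ((contDiffAt_covectorInChart hs hy).differentiableAt (by simp))]
    rfl
  rw [inChart_apply, phi_toModel_apply hB]
  simp only [csForm, hcurl]
  rfl

theorem phi_toModel_apply_curl
    (hB : IsQuadraticBracket (LinearMap.toContinuousBilinearMap B) (lie E D))
    (hs : IsSmoothForm (oneForm s)) (x : D ⧸ G) (v : Fin 3 → F) : (phi B s).toModel x v =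
      csForm (LinearMap.toContinuousBilinearMap B) (lie E D) (covectorAt s x)
        (curl (covectorDeriv s x)) (v 0) (v 1) (v 2) := by
  have h := inChart_phi hB hs (mem_extChartAt_target x) v
  rw [inChart_apply, tmap_symm_self, extChartAt_to_inv, covectorInChart_self] at h
  exact h

theorem isSmoothForm_phi [FiniteDimensional ℝ F]
    (hB : IsQuadraticBracket (LinearMap.toContinuousBilinearMap B) (lie E D))
    (hs : IsSmoothForm (oneForm s)) : IsSmoothForm (phi B s) := fun x =>
  contDiffOn_alternating fun v =>
    (contDiffOn_csForm (isOpen_extChartAt_target x) (isSmoothForm_oneForm.1 hs x)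
      (LinearMap.toContinuousBilinearMap B) (lie E D) (v 0) (v 1) (v 2)).congr fun _ hy =>
        inChart_phi hB hs hy v

theorem extD_phi_toModel_apply [FiniteDimensional ℝ F]
    (hB : IsQuadraticBracket (LinearMap.toContinuousBilinearMap B) (lie E D))
    (hs : IsSmoothForm (oneForm s)) (x : D ⧸ G) (v : Fin 4 → F) :
    (extD (phi B s)).toModel x v =
      B (curv (lie E D) (covectorAt s x) (curl (covectorDeriv s x)) (v 0) (v 1))
          (curv (lie E D) (covectorAt s x) (curl (covectorDeriv s x)) (v 2) (v 3)) -
        B (curv (lie E D) (covectorAt s x) (curl (covectorDeriv s x)) (v 0) (v 2))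
          (curv (lie E D) (covectorAt s x) (curl (covectorDeriv s x)) (v 1) (v 3)) +
        B (curv (lie E D) (covectorAt s x) (curl (covectorDeriv s x)) (v 0) (v 3))
          (curv (lie E D) (covectorAt s x) (curl (covectorDeriv s x)) (v 1) (v 2)) := by
  have hs_two : ContDiffAt ℝ 2 (covectorInChart s x) (extChartAt 𝓘(ℝ, F) x x) :=
    (contDiffAt_covectorInChart hs (mem_extChartAt_target x)).of_le (WithTop.coe_le_coe.2 le_top)
  have hderiv (w : Fin 3 → F) (W : F) :
      fderiv ℝ (fun y => inChart (phi B s) x y w) (extChartAt 𝓘(ℝ, F) x x) W =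
        csFormDeriv (LinearMap.toContinuousBilinearMap B) (lie E D) (covectorAt s x)
          (covectorDeriv s x) (fderiv ℝ (fderiv ℝ (covectorInChart s x)) (extChartAt 𝓘(ℝ, F) x x))
          W (w 0) (w 1) (w 2) := by
    have hcs : (fun y => inChart (phi B s) x y w) =ᶠ[𝓝 (extChartAt 𝓘(ℝ, F) x x)] fun y =>
        csForm (LinearMap.toContinuousBilinearMap B) (lie E D) (covectorInChart s x y)
          (curl (fderiv ℝ (covectorInChart s x) y)) (w 0) (w 1) (w 2) :=
      Filter.eventually_of_mem (extChartAt_target_mem_nhds x) fun y hy => inChart_phi hB hs hy w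
    rw [hcs.fderiv_eq, hB.fderiv_csForm hs_two, covectorInChart_self, covectorDeriv]
  rw [extD_toModel_apply, extDeriv_apply_three
    ((isSmoothForm_phi hB hs).differentiableAt (mem_extChartAt_target x)),
    hderiv, hderiv, hderiv, hderiv]
  exact hB.csForm_closed (covectorAt s x) (covectorDeriv s x)
    (hs_two.isSymmSndFDerivAt (by simp)).eq (v 0) (v 1) (v 2) (v 3)

end ChernSimonsForm

section Splitting

variable {E : Type*} [NormedAddCommGroup E] [NormedSpace ℝ E]
  {F : Type*} [NormedAddCommGroup F] [NormedSpace ℝ F]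
  {D : Type*} [TopologicalSpace D] [ChartedSpace E D] [Group D]
  {G : Subgroup D} [ChartedSpace F (D ⧸ G)]
  {B : LinearMap.BilinForm ℝ (LieAlg E D)}
  {s : ∀ x : D ⧸ G, TangentSpace 𝓘(ℝ, F) x →L[ℝ] LieAlg E D}

local notation "κ" => extChartAt 𝓘(ℝ, E) (1 : D)

theorem IsConnectionSplitting.rhoL_apply (hs : IsConnectionSplitting B s) (x : D ⧸ G) (X : F) :
    rhoL E F x (covectorAt s x X) = X :=
  hs.rho_apply x X

theorem IsConnectionSplitting.rhoL_sub_apply (hs : IsConnectionSplitting B s) (x : D ⧸ G)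
    (v : LieAlg E D) : rhoL E F x (covectorAt s x (rhoL E F x v) - v) = 0 := by
  rw [map_sub, hs.rhoL_apply, sub_self]

theorem IsConnectionSplitting.finiteDimensional [FiniteDimensional ℝ E]
    (hs : IsConnectionSplitting B s) : FiniteDimensional ℝ F :=
  Module.Finite.of_surjective (rhoL E F ((1 : D) : D ⧸ G)).toLinearMap fun X =>
    ⟨_, hs.rhoL_apply _ X⟩

theorem form_covectorDeriv_swap [FiniteDimensional ℝ E] [IsManifold 𝓘(ℝ, F) ∞ (D ⧸ G)]
    (hB_symm : ∀ u v, B u v = B v u) (hs : IsConnectionSplitting B s) (x : D ⧸ G) (W X Y : F) :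
    B (covectorDeriv s x W X) (covectorAt s x Y) =
      -B (covectorDeriv s x W Y) (covectorAt s x X) := by
  have hderiv := ((contDiffAt_covectorInChart hs.smooth
    (mem_extChartAt_target x)).differentiableAt (by simp)).hasFDerivAt
  have hform := ((LinearMap.toContinuousBilinearMap B).hasFDerivAt.comp _
    (hderiv.clm_apply (hasFDerivAt_const X _))).clm_apply (hderiv.clm_apply (hasFDerivAt_const Y _))
  have hzero : (fun y => LinearMap.toContinuousBilinearMap B (covectorInChart s x y X)
      (covectorInChart s x y Y)) = fun _ => 0 := funext fun y =>
    hs.isotropic ((extChartAt 𝓘(ℝ, F) x).symm y) (tmap F F (extChartAt 𝓘(ℝ, F) x).symm y X)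
      (tmap F F (extChartAt 𝓘(ℝ, F) x).symm y Y)
  have h := DFunLike.congr_fun ((hzero ▸ hform : HasFDerivAt (fun _ : F => (0 : ℝ)) _ _).unique
    (hasFDerivAt_const (0 : ℝ) _)) W
  simp only [Function.comp_apply, ContinuousLinearMap.comp_zero, zero_add, add_apply, zero_apply,
    ContinuousLinearMap.comp_apply, ContinuousLinearMap.flip_apply,
    LinearMap.toContinuousBilinearMap_apply] at h
  rw [covectorInChart_self, hB_symm (covectorAt s x X)] at h
  exact eq_neg_of_add_eq_zero_right h

theorem hasDerivAt_chart_comp [IsManifold 𝓘(ℝ, E) ∞ D] {γ : ℝ → D} {v : E}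
    (hγ : MDifferentiableAt 𝓘(ℝ, ℝ) 𝓘(ℝ, E) γ 0) (hγ_zero : γ 0 = 1)
    (hγ_deriv : tmap ℝ E γ 0 1 = v) : HasDerivAt (fun t => κ (γ t)) v 0 := by
  have hκ : MDifferentiableAt 𝓘(ℝ, E) 𝓘(ℝ, E) κ (γ 0) :=
    mdifferentiableAt_chart (by rw [hγ_zero]; exact mem_extChartAt_source _)
  have hcomp := tmap_comp (0 : ℝ) hκ hγ
  rw [hγ_zero, tmap_chart_self, ContinuousLinearMap.id_comp, tmap_eq_fderiv] at hcomp
  have hderiv : deriv (fun t => κ (γ t)) 0 = v := (congrArg (fun l => l 1) hcomp).trans hγ_deriv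
  exact hderiv ▸ (hκ.comp 0 hγ).differentiableAt.hasDerivAt

variable [LieGroup 𝓘(ℝ, E) ∞ D] [IsManifold 𝓘(ℝ, F) ∞ (D ⧸ G)]

section Dressing

variable (hp : Manifold.IsSubmersion 𝓘(ℝ, E) 𝓘(ℝ, F) ∞ (QuotientGroup.mk : D → D ⧸ G))
include hp

theorem generator_covectorInChart (hs : IsConnectionSplitting B s) {x : D ⧸ G} {y : F}
    (hy : y ∈ (extChartAt 𝓘(ℝ, F) x).target) (X : F) :
    generator (locAct E F x) (κ 1) (covectorInChart s x y X : E) y = X :=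
  calc generator (locAct E F x) (κ 1) (covectorInChart s x y X : E) y
    _ = tmap F F (extChartAt 𝓘(ℝ, F) x) ((extChartAt 𝓘(ℝ, F) x).symm y)
        (rhoL E F ((extChartAt 𝓘(ℝ, F) x).symm y) (covectorInChart s x y X)) :=
      generator_locAct hp x _ hy
    _ = tmap F F (extChartAt 𝓘(ℝ, F) x) ((extChartAt 𝓘(ℝ, F) x).symm y)
        (tmap F F (extChartAt 𝓘(ℝ, F) x).symm y X) :=
      congrArg _ (hs.rhoL_apply _ (tmap F F (extChartAt 𝓘(ℝ, F) x).symm y X))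
    _ = X := DFunLike.congr_fun (tmap_chart_comp_symm hy) X

theorem lieBracket_generator_locAct [FiniteDimensional ℝ E] (x : D ⧸ G) (u v : LieAlg E D) :
    VectorField.lieBracket ℝ (generator (locAct E F x) (κ 1) u) (generator (locAct E F x) (κ 1) v)
      (extChartAt 𝓘(ℝ, F) x x) = rhoL E F x (lie E D u v) :=
  (isLocalMul_locMul.lieBracket_generator (contDiffAt_locAct hp x) (locAct_one x).self_of_nhds
    (eventually_locAct_locMul hp x) u v).trans <|
      (congrArg (fun w : E => generator (locAct E F x) (κ 1) w (extChartAt 𝓘(ℝ, F) x x))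
        (lieFun_eq_lieBracket u v).symm).trans (generator_locAct_self hp x (lieFun u v))

theorem rhoL_curv [FiniteDimensional ℝ E] (hs : IsConnectionSplitting B s) (x : D ⧸ G) (X Y : F) :
    rhoL E F x (curv (lie E D) (covectorAt s x) (curl (covectorDeriv s x)) X Y) = 0 := by
  have h := generator_curvature (s := (covectorInChart s x : F → F →L[ℝ] E))
    (contDiffAt_locAct hp x)
    ((contDiffAt_covectorInChart hs.smooth (mem_extChartAt_target x)).differentiableAt (by simp))
    (Filter.eventually_of_mem (extChartAt_target_mem_nhds x)
      fun y hy => generator_covectorInChart hp hs hy) X Y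
  have hself : (covectorInChart s x (extChartAt 𝓘(ℝ, F) x x) : F →L[ℝ] E) = covectorAt s x :=
    covectorInChart_self s x
  rw [hself] at h
  rw [curv, map_add, ← lieBracket_generator_locAct hp]
  exact (congrArg (· + _) (generator_locAct_self hp x _).symm).trans h

theorem covectorInChart_locAct (hs_equiv : IsEquivariant s) (g : G) {x : D ⧸ G}
    (hg : (g : D) ∈ (κ).source) (hgx : (g : D) • x ∈ (extChartAt 𝓘(ℝ, F) x).source) (X : F) :
    covectorInChart s x (locAct E F x (κ g, extChartAt 𝓘(ℝ, F) x x))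
        (fderiv ℝ (fun z => locAct E F x (κ g, z)) (extChartAt 𝓘(ℝ, F) x x) X) =
      Ad (g : D) (covectorAt s x X) := by
  have hderiv := fderiv_inCharts_self
    ((contMDiff_dressing_left hp (g : D)).mdifferentiable (by simp) x) hgx
  have hlocAct : (fun z => locAct E F x (κ g, z)) = inCharts F F (fun y => (g : D) • y) x x := by
    funext z
    rw [locAct, (κ).left_inv hg, inCharts]
  have hvalue : locAct E F x (κ g, extChartAt 𝓘(ℝ, F) x x) =
      extChartAt 𝓘(ℝ, F) x ((g : D) • x) := by
    rw [locAct, (κ).left_inv hg, extChartAt_to_inv]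
  rw [hlocAct, hvalue, hderiv, ContinuousLinearMap.comp_apply, covectorInChart_tmap_chart s hgx]
  exact hs_equiv g x X

theorem covectorDeriv_rhoL_of_isVelocity [FiniteDimensional ℝ E]
    (hs : IsSmoothForm (oneForm s)) (hs_equiv : IsEquivariant s) (x : D ⧸ G) {v : LieAlg E D}
    (hv : IsVelocity G v) (X : F) :
    ∃ X' : F, covectorDeriv s x (rhoL E F x v) X + covectorAt s x X' =
      lie E D (covectorAt s x X) v := by
  obtain ⟨γ, hγ, hγ_zero, hγ_mem, hγ_deriv⟩ := hv
  have hγ_deriv : tmap ℝ E γ 0 1 = v := hγ_deriv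
  have hγ_diff := hγ.mdifferentiable (by simp) 0
  have hκγ := hasDerivAt_chart_comp hγ_diff hγ_zero hγ_deriv
  have hsource : ∀ᶠ t in 𝓝 (0 : ℝ), γ t ∈ (κ).source :=
    hγ.continuous.continuousAt.eventually ((isOpen_extChartAt_source (1 : D)).mem_nhds
      (by rw [hγ_zero]; exact mem_extChartAt_source _))
  have horbit : ∀ᶠ t in 𝓝 (0 : ℝ), γ t • x ∈ (extChartAt 𝓘(ℝ, F) x).source :=
    ((contMDiff_dressing_right hp x).continuous.comp hγ.continuous).continuousAt.eventually
      ((isOpen_extChartAt_source x).mem_nhds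
        (by simp only [Function.comp_apply, hγ_zero, one_smul, mem_extChartAt_source]))
  have hequiv : ∀ᶠ t in 𝓝 (0 : ℝ),
      covectorInChart s x (locAct E F x (κ (γ t), extChartAt 𝓘(ℝ, F) x x))
        (fderiv ℝ (fun z => locAct E F x (κ (γ t), z)) (extChartAt 𝓘(ℝ, F) x x) X) =
      Ad (γ t) (covectorAt s x X) := by
    filter_upwards [hsource, horbit] with t ht ht'
    exact covectorInChart_locAct hp hs_equiv ⟨γ t, hγ_mem t⟩ ht ht' X
  have h := infinitesimal_equivariance
    ((contDiffAt_covectorInChart hs (mem_extChartAt_target x)).differentiableAt (by simp)) hκγ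
    (by rw [hγ_zero]; exact contDiffAt_locAct hp x) (by rw [hγ_zero]; exact locAct_one x)
    (hasDerivAt_Ad_along hγ_diff hγ_zero hγ_deriv (covectorAt s x X)) X hequiv
  have hgenerator := generator_locAct_self hp x v
  rw [hγ_zero, covectorInChart_self, hgenerator] at h
  exact ⟨_, h⟩

/-- `X'` is the derivative of the vector field `ρ_S(v)` along `X` in the chart at `x`. -/
theorem covectorDeriv_rhoL [FiniteDimensional ℝ E] (hs : IsSmoothForm (oneForm s))
    (hs_equiv : IsEquivariant s) (x : D ⧸ G) {v : LieAlg E D} (hv : v ∈ lieSub E G) (X : F) :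
    ∃ X' : F, covectorDeriv s x (rhoL E F x v) X + covectorAt s x X' =
      lie E D (covectorAt s x X) v := by
  induction hv using Submodule.span_induction with
  | mem v hv => exact covectorDeriv_rhoL_of_isVelocity hp hs hs_equiv x hv X
  | zero => exact ⟨0, by simp only [map_zero, zero_apply, add_zero]⟩
  | add u v _ _ hu hv =>
    obtain ⟨X₁, hX₁⟩ := hu
    obtain ⟨X₂, hX₂⟩ := hv
    refine ⟨X₁ + X₂, ?_⟩
    rw [map_add, map_add, map_add, map_add, ← hX₁, ← hX₂, add_apply]
    abel
  | smul c v _ hv =>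
    obtain ⟨X₁, hX₁⟩ := hv
    exact ⟨c • X₁, by rw [map_smul, map_smul, map_smul, map_smul, ← hX₁, smul_apply, smul_add]⟩

theorem extD_splitting_equivariant (hs : IsSmoothForm (oneForm s)) (hs_equiv : IsEquivariant s)
    (g : G) (x : D ⧸ G) (w : Fin 2 → F) :
    (extD (oneForm s)).toModel ((g : D) • x)
        (fun i => tmap F F (fun y : D ⧸ G => (g : D) • y) x (w i)) =
      Ad (g : D) ((extD (oneForm s)).toModel x w) := by
  have hpullback : pullback (fun y : D ⧸ G => (g : D) • y) (oneForm s) =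
      oneForm fun x => (AdL (g : D)).comp (s x) :=
    FormField.ext_toModel fun x w => hs_equiv g x (w 0)
  rw [← pullback_toModel_apply, ← extD_pullback hs (contMDiff_dressing_left hp (g : D)),
    hpullback, extD_comp_oneForm_apply hs, AdL_apply]

end Dressing

end Splitting

section Cartan

variable {E : Type*} [NormedAddCommGroup E] [NormedSpace ℝ E] [FiniteDimensional ℝ E]
  {F : Type*} [NormedAddCommGroup F] [NormedSpace ℝ F]
  {D : Type*} [TopologicalSpace D] [ChartedSpace E D] [Group D]
  {G : Subgroup D} [ChartedSpace F (D ⧸ G)]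
  {B : LinearMap.BilinForm ℝ (LieAlg E D)}
  {s : ∀ x : D ⧸ G, TangentSpace 𝓘(ℝ, F) x →L[ℝ] LieAlg E D}

variable (F) in
/-- The linear map `σ : 𝔤 → Ω¹(S)`. -/
noncomputable def sigmaLinear (B : LinearMap.BilinForm ℝ (LieAlg E D))
    (s : ∀ x : D ⧸ G, TangentSpace 𝓘(ℝ, F) x →L[ℝ] LieAlg E D) :
    lieSub E G →ₗ[ℝ] FormField F (D ⧸ G) 1 ℝ where
  toFun v := sigma B s v
  map_add' u v := FormField.ext_toModel fun x w => map_add (B (covectorAt s x (w 0))) u.1 v.1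
  map_smul' c v := FormField.ext_toModel fun x w => map_smul (B (covectorAt s x (w 0))) c v.1

variable [LieGroup 𝓘(ℝ, E) ∞ D]

theorem pullback_sigma (hB_ad : ∀ (a : D) (u v : LieAlg E D), B (Ad a u) (Ad a v) = B u v)
    (hs_equiv : IsEquivariant s) (g : G) (v : lieSub E G) :
    pullback (fun y : D ⧸ G => (g : D) • y) (sigma B s (adSub G g v)) = sigma B s v :=
  FormField.ext_toModel fun x w =>
    (congrArg (fun u => B u (Ad (g : D) v)) (hs_equiv g x (w 0))).trans (hB_ad g (s x (w 0)) v)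

theorem contract_sigma
    (hp : Manifold.IsSubmersion 𝓘(ℝ, E) 𝓘(ℝ, F) ∞ (QuotientGroup.mk : D → D ⧸ G))
    (hB_symm : ∀ u v, B u v = B v u)
    (hB_ad : ∀ (a : D) (u v : LieAlg E D), B (Ad a u) (Ad a v) = B u v)
    (hG_isotropic : IsIsotropic B (lieSub E G)) (hs : IsConnectionSplitting B s)
    (v : lieSub E G) : contract (rho F (v : LieAlg E D)) (sigma B s v) = 0 := by
  refine FormField.ext_toModel fun x w => ?_
  have hkernel := hs.rhoL_sub_apply x v
  have hdiff := form_eq_zero_of_rho_eq_zero hp hB_ad hG_isotropic hkernel hkernel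
  have hs_zero : B (covectorAt s x (rhoL E F x v)) (covectorAt s x (rhoL E F x v)) = 0 :=
    hs.isotropic x (rhoL E F x v) (rhoL E F x v)
  have hv_zero := hG_isotropic v v.2 v v.2
  simp only [map_sub, LinearMap.sub_apply, hs_zero, hv_zero, hB_symm v] at hdiff
  change B (covectorAt s x (rhoL E F x v)) v = 0
  linarith

variable [IsManifold 𝓘(ℝ, F) ∞ (D ⧸ G)]
  (hp : Manifold.IsSubmersion 𝓘(ℝ, E) 𝓘(ℝ, F) ∞ (QuotientGroup.mk : D → D ⧸ G))
  (hB_symm : ∀ u v, B u v = B v u)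
  (hB_ad : ∀ (a : D) (u v : LieAlg E D), B (Ad a u) (Ad a v) = B u v)
  (hG_isotropic : IsIsotropic B (lieSub E G))
  (hs : IsConnectionSplitting B s) (hs_equiv : IsEquivariant s)
include hp hB_symm hB_ad hs

include hs_equiv in
theorem pullback_phi (g : G) :
    pullback (fun y : D ⧸ G => (g : D) • y) (phi B s) = phi B s := by
  refine FormField.ext_toModel fun x w => ?_
  have hcovector (X : F) : covectorAt s ((g : D) • x)
      (tmap F F (fun y : D ⧸ G => (g : D) • y) x X) = Ad (g : D) (covectorAt s x X) :=
    hs_equiv g x X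
  have hextD (X Y : F) : (extD (oneForm s)).toModel ((g : D) • x)
      ![tmap F F (fun y : D ⧸ G => (g : D) • y) x X,
        tmap F F (fun y : D ⧸ G => (g : D) • y) x Y] =
      Ad (g : D) ((extD (oneForm s)).toModel x ![X, Y]) := by
    rw [← extD_splitting_equivariant hp hs.smooth hs_equiv]
    congr 1
    ext i
    fin_cases i <;> rfl
  have hB := isQuadraticBracket_lie hB_symm hB_ad
  rw [pullback_toModel_apply, phi_toModel_apply hB, phi_toModel_apply hB]
  simp only [csForm, hcovector, hextD, lie_Ad, LinearMap.toContinuousBilinearMap_apply, hB_ad]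

include hs_equiv in
theorem isCartanCochain_sigmaPlusPhi : IsCartanCochain 3 (sigmaPlusPhi B s) where
  homogeneous i j hij := by
    obtain ⟨rfl, rfl⟩ | ⟨rfl, rfl⟩ : i = 1 ∧ j = 1 ∨ i = 0 ∧ j = 3 := by omega
    · exact ⟨MultilinearMap.ofSubsingleton ℝ _ _ 0 (sigmaLinear F B s), fun v => rfl⟩
    · exact ⟨MultilinearMap.constOfIsEmpty ℝ _ (phi B s), fun v => rfl⟩
  eq_zero j hj v :=
    match j with
    | 0 | 2 | _ + 4 => rfl
    | 1 => absurd rfl (hj 1)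
    | 3 => absurd rfl (hj 0)
  smooth v j :=
    have := hs.finiteDimensional
    match j with
    | 0 | 2 | _ + 4 => isSmoothForm_zero
    | 1 => isSmoothForm_sigma hs.smooth v
    | 3 => isSmoothForm_phi (isQuadraticBracket_lie hB_symm hB_ad) hs.smooth
  invariant g v j :=
    match j with
    | 0 | 2 | _ + 4 => rfl
    | 1 => pullback_sigma hB_ad hs_equiv g v
    | 3 => pullback_phi hp hB_symm hB_ad hs hs_equiv g

include hG_isotropic

theorem extD_phi : extD (phi B s) = 0 := by
  have := hs.finiteDimensional
  refine FormField.ext_toModel fun x v => ?_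
  have hcurv (W X Y Z : F) :
      B (curv (lie E D) (covectorAt s x) (curl (covectorDeriv s x)) W X)
        (curv (lie E D) (covectorAt s x) (curl (covectorDeriv s x)) Y Z) = 0 :=
    form_eq_zero_of_rho_eq_zero hp hB_ad hG_isotropic (rhoL_curv hp hs x W X)
      (rhoL_curv hp hs x Y Z)
  rw [extD_phi_toModel_apply (isQuadraticBracket_lie hB_symm hB_ad) hs.smooth, hcurv, hcurv, hcurv,
    sub_zero, add_zero]
  rfl

include hs_equiv

theorem extD_sigma (v : lieSub E G) :
    extD (sigma B s v) = contract (rho F (v : LieAlg E D)) (phi B s) := by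
  refine FormField.ext_toModel fun x w => ?_
  have hB := isQuadraticBracket_lie hB_symm hB_ad
  have hequiv : B (covectorDeriv s x (rhoL E F x v) (w 0)) (covectorAt s x (w 1)) =
      B (lie E D (covectorAt s x (w 0)) v) (covectorAt s x (w 1)) := by
    obtain ⟨X', hX'⟩ := covectorDeriv_rhoL hp hs.smooth hs_equiv x v.2 (w 0)
    have hs_zero : B (covectorAt s x X') (covectorAt s x (w 1)) = 0 := hs.isotropic x X' (w 1)
    rw [← hX', map_add, LinearMap.add_apply, hs_zero, add_zero]
  have hcurv : B (curv (lie E D) (covectorAt s x) (curl (covectorDeriv s x)) (w 0) (w 1))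
      (covectorAt s x (rhoL E F x v)) =
      B (curv (lie E D) (covectorAt s x) (curl (covectorDeriv s x)) (w 0) (w 1)) v := by
    rw [← sub_eq_zero, ← map_sub]
    exact form_eq_zero_of_rho_eq_zero hp hB_ad hG_isotropic (rhoL_curv hp hs x (w 0) (w 1))
      (hs.rhoL_sub_apply x v)
  have hgenerator : csForm (LinearMap.toContinuousBilinearMap B) (lie E D) (covectorAt s x)
      (curl (covectorDeriv s x)) (rhoL E F x v) (w 0) (w 1) =
      B (curl (covectorDeriv s x) (w 0) (w 1)) v :=
    hB.csForm_generator (form_covectorDeriv_swap hB_symm hs x) hequiv hcurv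
  have hphi := phi_toModel_apply_curl hB hs.smooth x (Matrix.vecCons (rhoL E F x v) w)
  rw [extD_sigma_toModel_apply hs.smooth, ← hgenerator]
  exact hphi.symm

theorem cartanD_sigmaPlusPhi : cartanD (sigmaPlusPhi B s) = 0 := by
  funext v j
  match j with
  | 0 => exact neg_eq_zero.2 (contract_sigma hp hB_symm hB_ad hG_isotropic hs v)
  | 1 | 3 | _ + 5 => exact sub_eq_zero.2 extD_zero
  | 2 => exact sub_eq_zero.2 (extD_sigma hp hB_symm hB_ad hG_isotropic hs hs_equiv v)
  | 4 => exact sub_eq_zero.2 (extD_phi hp hB_symm hB_ad hG_isotropic hs)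

end Cartan

end GroupPair

theorem proposition3p9_general
    {E : Type*} [NormedAddCommGroup E] [NormedSpace ℝ E] [FiniteDimensional ℝ E]
    {F : Type*} [NormedAddCommGroup F] [NormedSpace ℝ F]
    {D : Type*} [TopologicalSpace D] [ChartedSpace E D] [Group D] [LieGroup 𝓘(ℝ, E) ∞ D]
    {G : Subgroup D} [ChartedSpace F (D ⧸ G)] [IsManifold 𝓘(ℝ, F) ∞ (D ⧸ G)]
    (hp : Manifold.IsSubmersion 𝓘(ℝ, E) 𝓘(ℝ, F) ∞ (QuotientGroup.mk : D → D ⧸ G))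
    {B : LinearMap.BilinForm ℝ (GroupPair.LieAlg E D)} (hB_symm : ∀ u v, B u v = B v u)
    (hB_ad : ∀ (a : D) (u v : GroupPair.LieAlg E D),
      B (GroupPair.Ad a u) (GroupPair.Ad a v) = B u v)
    (hG_isotropic : GroupPair.IsIsotropic B (GroupPair.lieSub E G))
    {s : ∀ x : D ⧸ G, TangentSpace 𝓘(ℝ, F) x →L[ℝ] GroupPair.LieAlg E D}
    (hs : GroupPair.IsConnectionSplitting B s) (hs_equiv : GroupPair.IsEquivariant s) :
    GroupPair.IsCartanCochain 3 (GroupPair.sigmaPlusPhi B s) ∧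
      GroupPair.cartanD (GroupPair.sigmaPlusPhi B s) = 0 :=
  ⟨GroupPair.isCartanCochain_sigmaPlusPhi hp hB_symm hB_ad hs hs_equiv,
    GroupPair.cartanD_sigmaPlusPhi hp hB_symm hB_ad hG_isotropic hs hs_equiv⟩

/-- `S = D ⧸ G` carries its quotient manifold structure, which is the (unique) smooth structure on
the quotient space for which the projection `D → D ⧸ G` is a submersion. -/
theorem proposition3p9
    {E : Type*} [NormedAddCommGroup E] [NormedSpace ℝ E] [FiniteDimensional ℝ E]
    {F : Type*} [NormedAddCommGroup F] [NormedSpace ℝ F] [FiniteDimensional ℝ F]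
    {D : Type*} [TopologicalSpace D] [ChartedSpace E D] [Group D] [LieGroup 𝓘(ℝ, E) ∞ D]
    [T2Space D] [ConnectedSpace D]
    (G : Subgroup D) (hG_closed : IsClosed (G : Set D)) (hG_conn : IsConnected (G : Set D))
    [ChartedSpace F (D ⧸ G)] [IsManifold 𝓘(ℝ, F) ∞ (D ⧸ G)]
    (hp : Manifold.IsSubmersion 𝓘(ℝ, E) 𝓘(ℝ, F) ∞ (QuotientGroup.mk : D → D ⧸ G))
    (n : ℕ) (B : LinearMap.BilinForm ℝ (GroupPair.LieAlg E D)) (hB : GroupPair.IsManinPair G B n)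
    (s : ∀ x : D ⧸ G, TangentSpace 𝓘(ℝ, F) x →L[ℝ] GroupPair.LieAlg E D)
    (hs : GroupPair.IsConnectionSplitting B s) (hs_equiv : GroupPair.IsEquivariant s) :
    GroupPair.IsCartanCochain 3 (GroupPair.sigmaPlusPhi B s) ∧ GroupPair.cartanD (GroupPair.sigmaPlusPhi B s) = 0 := by
  exact proposition3p9_general hp hB.symm hB.ad_invariant hB.maximal_isotropic.prop hs hs_equiv
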